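/- **Theories.** Expressions over an alphabet $W$ are variables and formal applications $w(e_1,\dots,e_n)$ with $w\in W$. Judgements $\Gamma\vdash T\ \mathsf{type}$, $\Gamma\vdash t:T$, $\Gamma\vdash T=T'\ \mathsf{type}$, $\Gamma\vdash t=t':T$ over contexts $\Gamma=(x_1:T_1,\dots,x_{n-1}:T_{n-1})$ are taken up to renaming of variables; the *degree* of such a judgement is $n$. The *boundary* of $\Gamma,x:T\vdash T'\ \mathsf{type}$ and of $\Gamma\vdash t:T$ is $\Gamma\vdash T\ \mathsf{type}$; the boundary of $\vdash T\ \mathsf{type}$ is empty; the boundary of an equality judgement consists of the two judgements that assert its two sides. The deduction rules are reflexivity, symmetry and transitivity of both equalities, conversion of $\Gamma\vdash t:T_1$ and of $\Gamma\vdash t_1=t_2:T_1$ and of $\Gamma,x:T_1,\Delta\vdash\mathcal J$ along $\Gamma\vdash T_1=T_2\ \mathsf{type}$, and the three substitution rules: from $\Gamma\vdash t:T$ and $\Gamma,y:T,\Delta\vdash\mathcal J$ derive $\Gamma,\Delta[t/y]\vdash\mathcal J[t/y]$; from $\Gamma\vdash t_1=t_2:T$ and $\Gamma,y:T,\Delta\vdash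 T'\ \mathsf{type}$ (resp. $\Gamma,y:T,\Delta\vdash t':T'$) derive $\Gamma,\Delta[t_2/y]\vdash T'[t_1/y]=T'[t_2/y]\ \mathsf{type}$ (resp. $\Gamma,\Delta[t_2/y]\vdash t'[t_1/y]=t'[t_2/y]:T'[t_2/y]$). (There are no weakening or projection rules.) An *$\{s\}$-GAT* $\mathbb T$ consists of sets of type-constants and of term-constants and a set $\Lambda$ of basic judgements over their union: exactly one judgement $x_1:T_1,\dots,x_{n-1}:T_{n-1}\vdash A(x_1,\dots,x_{n-1})\ \mathsf{type}$ for each type-constant $A$, exactly one judgement $x_1:T_1,\dots,x_{n-1}:T_{n-1}\vdash f(x_1,\dots,x_{n-1}):T$ for each term-constant $f$, and otherwise only equality judgements. The derived judgements of $\mathbb T$ are the smallest collection that is closed under the rules and contains each $\mathcal J\in\Lambda$ whose boundary it contains; every element of $\Lambda$ is required to be derived. Two derived type judgements of the same degree with successive types $S_1,\dots,S_n$ and $T_1,\dots,T_n$ are congruent, $\equiv$, if $x_1:S_1,\dots,x_{i-1}:S_{i-1}\vdash S_i=T_i\ \mathsf{type}$ is derived for all $i$; two derived term judgements $x_1:S_1,\dots,x_{n-1}:S_{n-1}\vdash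 s:S_n$ and $x_1:T_1,\dots,x_{n-1}:T_{n-1}\vdash t:T_n$ are congruent if their boundaries are and $x_1:S_1,\dots,x_{n-1}:S_{n-1}\vdash s=t:S_n$ is derived. An interpretation $\mathbb T\to\mathbb U$ is a map of derived judgements that preserves the form of judgements, boundaries, and instances of the rules. The category $\{s\}\text{-}\mathbf{GAT}$ has as morphisms interpretations, two being identified if they agree up to $\equiv$ on all derived type and term judgements. **Type-and-term structures.** Let $\mathbb H$ be the category freely generated by the graph with vertices $n,n_t$ ($n\ge1$) and edges $n\to n+1$ and $n\to n_t$. A type-and-term structure is a presheaf $X\in[\mathbb H^{\mathrm{op}},\mathbf{Set}]$; the induced maps $X(n+1)\to X(n)$ and $X(n_t)\to X(n)$ are called $\partial$. For $A\in X(n)$ put $\mathrm{Tm}_X(A)=\{a\in X(n_t):\partial a=A\}$. The functor $V:\{s\}\text{-}\mathbf{GAT}\to[\mathbb H^{\mathrm{op}},\mathbf{Set}]$ takes $\mathbb T$ to its derived type judgements ($V\mathbb T(n)$) and term judgements ($V\mathbb T(n_t)$) of degree $n$ modulo $\equiv$, with the boundary maps. It has a left adjoint $G$: the constants of $GX$ are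 the elements of $X$, and its basic judgements are $x_1:A_1,\dots,x_{n-1}:A_{n-1}(x_1,\dots,x_{n-2})\vdash A(x_1,\dots,x_{n-1})\ \mathsf{type}$ for $A\in X(n)$ with successive boundaries $A_{n-1},\dots,A_1$, and the same with $\vdash a(x_1,\dots,x_{n-1}):A(x_1,\dots,x_{n-1})$ for $a\in\mathrm{Tm}_X(A)$. The *substitution monad* is $S=VG$ with multiplication $\mu:S^2\Rightarrow S$ induced by this adjunction. **Inc-lists.** For $n\ge1$, an inc-list of length $n$ is a strictly increasing function $\alpha:\{0,\dots,n\}\to\mathbb N$ with $\alpha(0)=0$; let $\mathrm{Inc}(n)$ be the set of these. Let $[\alpha]$ be the type-and-term structure with $[\alpha](i)=\{i\}$ for $1\le i\le\alpha(n)$, with $[\alpha](i_t)=\{i_t\}$ for $1\le i\le\alpha(n)$, $i\notin\operatorname{im}\alpha$, with the other values empty, and with the only possible boundary maps. For $h:[\alpha]\to X$ and $1\le m\le n$ let $(\alpha,h)|_m$ be the restriction of $\alpha$ to $\{0,\dots,m\}$ together with the restriction of $h$. Define expressions over the elements of $X$ by $e_j=x_p$ if $j=\alpha(p)$, and $e_j=h(j_t)(e_1,\dots,e_{j-1})$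 if $1\le j\le\alpha(n)$ and $j\notin\operatorname{im}\alpha$, and let $T_m=h(\alpha(m))(e_1,\dots,e_{\alpha(m)-1})$. Then $x_1:T_1,\dots,x_{n-1}:T_{n-1}\vdash T_n\ \mathsf{type}$ is a derived judgement of $GX$; write $(\alpha,h)\in SX(n)$ for its class. For $a\in\mathrm{Tm}_X(h(\alpha(n)))$ the judgement $x_1:T_1,\dots,x_{n-1}:T_{n-1}\vdash a(e_1,\dots,e_{\alpha(n)-1}):T_n$ is derived too; write again $a\in\mathrm{Tm}_{SX}(\alpha,h)$ for its class. **Elements of $S^2X$.** Given $\alpha\in\mathrm{Inc}(n)$, $\beta\in\mathrm{Inc}(\alpha(n))$, $h:[\beta]\to X$ and $k(j)\in\mathrm{Tm}_X(h(\beta(j)))$ for all $1\le j\le\alpha(n)$ with $j\notin\operatorname{im}\alpha$, let $(\beta,h,k):[\alpha]\to SX$ be the map with $j\mapsto(\beta,h)|_j$ and $j_t\mapsto k(j)\in\mathrm{Tm}_{SX}((\beta,h)|_j)$. By the above, with $SX$ in place of $X$, this gives a type-element $(\alpha,(\beta,h,k))\in S^2X(n)$, and each $a\in\mathrm{Tm}_X(h(\beta(\alpha(n))))$,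 seen as an element of $\mathrm{Tm}_{SX}(\beta,h)$, gives a term-element $a\in\mathrm{Tm}_{S^2X}(\alpha,(\beta,h,k))$. Let $\beta\alpha\in\mathrm{Inc}(n)$ be given by $(\beta\alpha)(i)=\beta(\alpha(i))$, and let $h\cup k:[\beta\alpha]\to X$ be given by $(h\cup k)(i)=h(i)$ for $1\le i\le\beta\alpha(n)$ and, for those $i$ that are not in $\operatorname{im}\beta\alpha$, by $$(h\cup k)(i_t)=\begin{cases}h(i_t)&\text{if }i\notin\operatorname{im}\beta,\\ k(j)&\text{if }i=\beta(j),\ j\notin\operatorname{im}\alpha.\end{cases}$$ **Proposition.** Let $X$ be a type-and-term structure and $n\ge1$. Every element of $SX(n)$ is $(\alpha,h)$ for exactly one pair $\alpha\in\mathrm{Inc}(n)$, $h:[\alpha]\to X$, and $a\mapsto a$ is a bijection $\mathrm{Tm}_X(h(\alpha(n)))\cong\mathrm{Tm}_{SX}(\alpha,h)$. Likewise every element of $S^2X(n)$ is $(\alpha,(\beta,h,k))$ for exactly one choice of data $\alpha,\beta,h,k$ as above, and $a\mapsto a$ is a bijection $\mathrm{Tm}_X(h(\beta(\alpha(n))))\cong\mathrm{Tm}_{S^2X}(\alpha,(\beta,h,k))$.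 In terms of these descriptions, the multiplication $\mu_X:S^2X\to SX$ of the substitution monad is given by $$S^2X(n)\to SX(n),\quad(\alpha,(\beta,h,k))\mapsto(\beta\alpha,h\cup k),\qquad \mathrm{Tm}_{S^2X}(\alpha,(\beta,h,k))\to\mathrm{Tm}_{SX}(\beta\alpha,h\cup k),\quad a\mapsto a.$$ -/

import Mathlib

open CategoryTheory Opposite

universe u

namespace SubstMonad

/-! ## Raw syntax -/

/-- Expressions over an alphabet `W`.  The variables of a context `x₀ : T₀, …, xₙ₋₁ : Tₙ₋₁` are
represented by their positions, so that expressions and judgements are taken up to renaming of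
variables. -/
inductive Expr (W : Type u) : Type u
  | var (i : ℕ) : Expr W
  | app (w : W) (n : ℕ) (args : Fin n → Expr W) : Expr W

/-- The substitution `e[t/x_k]`, where `x_k` is removed from the context:
the variables after `x_k` move down by one position. -/
def Expr.subst {W : Type u} (e : Expr W) (k : ℕ) (t : Expr W) : Expr W :=
  match e with
  | .var i => if i < k then .var i else if i = k then t else .var (i - 1)
  | .app w n args => .app w n fun i => (args i).subst k t

/-- Substitution in all types of a list. -/
def substCtx {W : Type u} (Δ : List (Expr W)) (k : ℕ) (t : Expr W) : List (Expr W) :=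
  Δ.map fun e => e.subst k t

/-- The four forms of judgement. -/
inductive Form
  | type | term | typeEq | termEq

/-- What is to the right of the turnstile: `T type`, `t : T`, `T = T' type`, `t = t' : T`. -/
inductive Body (W : Type u) : Type u
  | type (T : Expr W) : Body W
  | term (t T : Expr W) : Body W
  | typeEq (T T' : Expr W) : Body W
  | termEq (t t' T : Expr W) : Body W

/-- The form of a judgement body. -/
def Body.form {W : Type u} : Body W → Form
  | .type _ => .type
  | .term _ _ => .term
  | .typeEq _ _ => .typeEq
  | .termEq _ _ _ => .termEq

/-- Substitution in a judgement body. -/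
def Body.subst {W : Type u} (b : Body W) (k : ℕ) (t : Expr W) : Body W :=
  match b with
  | .type T => .type (T.subst k t)
  | .term s T => .term (s.subst k t) (T.subst k t)
  | .typeEq T T' => .typeEq (T.subst k t) (T'.subst k t)
  | .termEq s s' T => .termEq (s.subst k t) (s'.subst k t) (T.subst k t)

/-- A judgement `Γ ⊢ 𝒥`.  The context is listed from right to left: `T :: Γ` is the context `Γ`
extended on the right by a variable of type `T`, and `Δ ++ T :: Γ` is `Γ, y : T, Δ`. -/
@[ext] structure Judgement (W : Type u) : Type u where
  ctx : List (Expr W)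
  body : Body W

/-- The degree of a judgement is one more than the length of its context. -/
def Judgement.degree {W : Type u} (J : Judgement W) : ℕ := J.ctx.length + 1

/-- The boundary of a judgement. -/
def Judgement.boundary {W : Type u} : Judgement W → List (Judgement W)
  | ⟨Γ, .term _ T⟩ => [⟨Γ, .type T⟩]
  | ⟨[], .type _⟩ => []
  | ⟨T :: Γ, .type _⟩ => [⟨Γ, .type T⟩]
  | ⟨Γ, .typeEq T T'⟩ => [⟨Γ, .type T⟩, ⟨Γ, .type T'⟩]
  | ⟨Γ, .termEq t t' T⟩ => [⟨Γ, .term t T⟩, ⟨Γ, .term t' T⟩]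

/-- Names of the deduction rules: the equality rules and the substitution rules. -/
inductive RuleName
  | termRefl | termSymm | termTrans | typeRefl | typeSymm | typeTrans
  | termConv | termEqConv | ctxConv
  | subst | substTypeEq | substTermEq

/-- `Rule r Js J`: the rule `r` has an instance with premisses `Js` and conclusion `J`. -/
inductive Rule {W : Type u} : RuleName → List (Judgement W) → Judgement W → Prop
  | termRefl (Γ t T) : Rule .termRefl [⟨Γ, .term t T⟩] ⟨Γ, .termEq t t T⟩
  | termSymm (Γ t₁ t₂ T) : Rule .termSymm [⟨Γ, .termEq t₁ t₂ T⟩] ⟨Γ, .termEq t₂ t₁ T⟩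
  | termTrans (Γ t₁ t₂ t₃ T) :
      Rule .termTrans [⟨Γ, .termEq t₁ t₂ T⟩, ⟨Γ, .termEq t₂ t₃ T⟩] ⟨Γ, .termEq t₁ t₃ T⟩
  | typeRefl (Γ T) : Rule .typeRefl [⟨Γ, .type T⟩] ⟨Γ, .typeEq T T⟩
  | typeSymm (Γ T₁ T₂) : Rule .typeSymm [⟨Γ, .typeEq T₁ T₂⟩] ⟨Γ, .typeEq T₂ T₁⟩
  | typeTrans (Γ T₁ T₂ T₃) :
      Rule .typeTrans [⟨Γ, .typeEq T₁ T₂⟩, ⟨Γ, .typeEq T₂ T₃⟩] ⟨Γ, .typeEq T₁ T₃⟩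
  | termConv (Γ T₁ T₂ t) :
      Rule .termConv [⟨Γ, .typeEq T₁ T₂⟩, ⟨Γ, .term t T₁⟩] ⟨Γ, .term t T₂⟩
  | termEqConv (Γ T₁ T₂ t₁ t₂) :
      Rule .termEqConv [⟨Γ, .typeEq T₁ T₂⟩, ⟨Γ, .termEq t₁ t₂ T₁⟩] ⟨Γ, .termEq t₁ t₂ T₂⟩
  | ctxConv (Γ T₁ T₂ Δ b) :
      Rule .ctxConv [⟨Γ, .typeEq T₁ T₂⟩, ⟨Δ ++ T₁ :: Γ, b⟩] ⟨Δ ++ T₂ :: Γ, b⟩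
  | subst (Γ t T Δ b) :
      Rule .subst [⟨Γ, .term t T⟩, ⟨Δ ++ T :: Γ, b⟩]
        ⟨substCtx Δ Γ.length t ++ Γ, b.subst Γ.length t⟩
  | substTypeEq (Γ t₁ t₂ T Δ T') :
      Rule .substTypeEq [⟨Γ, .termEq t₁ t₂ T⟩, ⟨Δ ++ T :: Γ, .type T'⟩]
        ⟨substCtx Δ Γ.length t₂ ++ Γ,
          .typeEq (T'.subst Γ.length t₁) (T'.subst Γ.length t₂)⟩
  | substTermEq (Γ t₁ t₂ T Δ t' T') :
      Rule .substTermEq [⟨Γ, .termEq t₁ t₂ T⟩, ⟨Δ ++ T :: Γ, .term t' T'⟩]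
        ⟨substCtx Δ Γ.length t₂ ++ Γ,
          .termEq (t'.subst Γ.length t₁) (t'.subst Γ.length t₂) (T'.subst Γ.length t₂)⟩

/-- The judgements derivable from a collection `Λ` of basic judgements: the smallest collection
that is closed under the rules and contains each `J ∈ Λ` whose boundary it contains. -/
inductive Derives {W : Type u} (Λ : Set (Judgement W)) : Judgement W → Prop
  | basic (J) : J ∈ Λ → (∀ K ∈ J.boundary, Derives Λ K) → Derives Λ J
  | rule (r Js J) : Rule r Js J → (∀ K ∈ Js, Derives Λ K) → Derives Λ J

section
variable {W : Type u} {Λ : Set (Judgement W)}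

namespace Derives

theorem rule1 {r J K} (h : Rule r [K] J) (hK : Derives Λ K) : Derives Λ J :=
  .rule r _ _ h (by simpa using hK)

theorem rule2 {r J K L} (h : Rule r [K, L] J) (hK : Derives Λ K) (hL : Derives Λ L) :
    Derives Λ J :=
  .rule r _ _ h (by simpa using ⟨hK, hL⟩)

theorem ctxConv {Γ : List (Expr W)} {T₁ T₂ b} (Δ : List (Expr W))
    (h : Derives Λ ⟨Γ, .typeEq T₁ T₂⟩)
    (h' : Derives Λ ⟨Δ ++ T₁ :: Γ, b⟩) : Derives Λ ⟨Δ ++ T₂ :: Γ, b⟩ :=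
  rule2 (.ctxConv Γ T₁ T₂ Δ b) h h'

theorem subst {Γ : List (Expr W)} {t T b} (Δ : List (Expr W)) (h : Derives Λ ⟨Γ, .term t T⟩)
    (h' : Derives Λ ⟨Δ ++ T :: Γ, b⟩) :
    Derives Λ ⟨substCtx Δ Γ.length t ++ Γ, b.subst Γ.length t⟩ :=
  rule2 (.subst Γ t T Δ b) h h'

end Derives

/-- All types of the context are derivable over the part of the context before them. -/
def CtxDer (Λ : Set (Judgement W)) (Γ : List (Expr W)) : Prop :=
  ∀ Δ T Ξ, Γ = Δ ++ T :: Ξ → Derives Λ ⟨Ξ, .type T⟩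

theorem CtxDer.nil : CtxDer Λ [] := by
  intro Δ T Ξ h; simp at h

theorem CtxDer.cons {Γ : List (Expr W)} {T} (h : CtxDer Λ Γ) (hT : Derives Λ ⟨Γ, .type T⟩) :
    CtxDer Λ (T :: Γ) := by
  intro Δ S Ξ e
  cases Δ with
  | nil => simp at e; obtain ⟨rfl, rfl⟩ := e; exact hT
  | cons D Δ => simp at e; exact h _ _ _ e.2

theorem CtxDer.tail {Γ : List (Expr W)} {T} (h : CtxDer Λ (T :: Γ)) : CtxDer Λ Γ := by
  rintro Δ S Ξ rfl
  exact h (T :: Δ) S Ξ rfl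

theorem CtxDer.head {Γ : List (Expr W)} {T} (h : CtxDer Λ (T :: Γ)) :
    Derives Λ ⟨Γ, .type T⟩ := h [] _ _ rfl

theorem CtxDer.append {Γ Δ : List (Expr W)} (h : CtxDer Λ (Δ ++ Γ)) : CtxDer Λ Γ := by
  rintro Δ' S Ξ rfl
  exact h (Δ ++ Δ') S Ξ (by simp)

/-- The parts of the boundary that live over the same context. -/
def Body.pre {W : Type u} : Body W → List (Body W)
  | .type _ => []
  | .term _ T => [.type T]
  | .typeEq T T' => [.type T, .type T']
  | .termEq t t' T => [.term t T, .term t' T]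

theorem Body.pre_subst {W : Type u} (b : Body W) (k t) :
    (b.subst k t).pre = b.pre.map fun c => c.subst k t := by
  cases b <;> rfl

/-- Conversion of the context of a judgement after replacing `t₁` by `t₂` in it. -/
theorem substCtx_conv {Γ : List (Expr W)} {t₁ t₂ T : Expr W}
    (h : Derives Λ ⟨Γ, .termEq t₁ t₂ T⟩) :
    ∀ (Δ : List (Expr W)) (_ : CtxDer Λ (Δ ++ T :: Γ)) (Ξ : List (Expr W)) (b : Body W),
      Derives Λ ⟨Ξ ++ (substCtx Δ Γ.length t₁ ++ Γ), b⟩ →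
      Derives Λ ⟨Ξ ++ (substCtx Δ Γ.length t₂ ++ Γ), b⟩ := by
  intro Δ
  induction Δ with
  | nil => intro _ Ξ b h; simpa [substCtx] using h
  | cons D Δ ih =>
    intro hΔ Ξ b hb
    have h1 := ih hΔ.tail (Ξ ++ [D.subst Γ.length t₁]) b (by simpa [substCtx] using hb)
    have h2 : Derives Λ ⟨substCtx Δ Γ.length t₂ ++ Γ,
        .typeEq (D.subst Γ.length t₁) (D.subst Γ.length t₂)⟩ :=
      .rule2 (.substTypeEq Γ t₁ t₂ T Δ D) h (CtxDer.head hΔ)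
    have h3 := Derives.ctxConv Ξ h2 (by simpa using h1)
    simpa [substCtx] using h3

theorem CtxDer.substCtx {Γ : List (Expr W)} {t T : Expr W} (h : Derives Λ ⟨Γ, .term t T⟩) :
    ∀ {Δ : List (Expr W)}, CtxDer Λ (Δ ++ T :: Γ) → CtxDer Λ (substCtx Δ Γ.length t ++ Γ)
  | [], hΔ => hΔ.tail
  | _ :: Δ, hΔ => (CtxDer.substCtx h hΔ.tail).cons (h.subst Δ hΔ.head)

theorem CtxDer.conv {Γ : List (Expr W)} {T₁ T₂ : Expr W} (h : Derives Λ ⟨Γ, .typeEq T₁ T₂⟩)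
    (hT : Derives Λ ⟨Γ, .type T₂⟩) :
    ∀ {Δ : List (Expr W)}, CtxDer Λ (Δ ++ T₁ :: Γ) → CtxDer Λ (Δ ++ T₂ :: Γ)
  | [], hΔ => hΔ.tail.cons hT
  | _ :: Δ, hΔ => (CtxDer.conv h hT hΔ.tail).cons (.ctxConv Δ h hΔ.head)

theorem Derives.presup' {J : Judgement W} (h : Derives Λ J) :
    CtxDer Λ J.ctx ∧ ∀ c ∈ J.body.pre, Derives Λ ⟨J.ctx, c⟩ := by
  induction h with
  | basic J hJ hb ih =>
    match J with
    | ⟨[], .type _⟩ => exact ⟨CtxDer.nil, by simp [Body.pre]⟩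
    | ⟨T :: Γ, .type _⟩ =>
      simp [Judgement.boundary] at hb ih
      exact ⟨ih.1.cons hb, by simp [Body.pre]⟩
    | ⟨Γ, .term _ T⟩ =>
      simp [Judgement.boundary] at hb ih
      exact ⟨ih.1, by simpa [Body.pre] using hb⟩
    | ⟨Γ, .typeEq T T'⟩ =>
      simp [Judgement.boundary] at hb ih
      exact ⟨ih.1.1, by simpa [Body.pre] using hb⟩
    | ⟨Γ, .termEq t t' T⟩ =>
      simp [Judgement.boundary] at hb ih
      exact ⟨ih.1.1, by simpa [Body.pre] using hb⟩
  | rule r Js J hr hd ih =>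
    cases hr <;> simp [Body.pre] at hd ih ⊢
    case termRefl => exact ⟨ih.1, hd⟩
    case termSymm => exact ⟨ih.1, ih.2.symm⟩
    case termTrans => exact ⟨ih.1.1, ih.1.2.1, ih.2.2.2⟩
    case typeRefl => exact ⟨ih, hd⟩
    case typeSymm => exact ⟨ih.1, ih.2.symm⟩
    case typeTrans => exact ⟨ih.1.1, ih.1.2.1, ih.2.2.2⟩
    case termConv => exact ⟨ih.1.1, ih.1.2.2⟩
    case termEqConv Γ T₁ T₂ t₁ t₂ =>
      exact ⟨ih.1.1, .rule2 (.termConv Γ T₁ T₂ t₁) hd.1 ih.2.2.1,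
        .rule2 (.termConv Γ T₁ T₂ t₂) hd.1 ih.2.2.2⟩
    case ctxConv Γ T₁ T₂ Δ b =>
      exact ⟨ih.2.1.conv hd.1 ih.1.2.2, fun c hc => .ctxConv Δ hd.1 (ih.2.2 c hc)⟩
    case subst Γ t T Δ b =>
      refine ⟨ih.2.1.substCtx hd.1, fun c hc => ?_⟩
      change c ∈ Body.pre _ at hc
      rw [Body.pre_subst, List.mem_map] at hc
      obtain ⟨c, hc, rfl⟩ := hc
      exact .subst Δ hd.1 (ih.2.2 c hc)
    case substTypeEq Γ t₁ t₂ T Δ T' =>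
      refine ⟨ih.2.substCtx ih.1.2.2, ?_, Derives.subst Δ ih.1.2.2 hd.2⟩
      exact substCtx_conv hd.1 Δ ih.2 [] _ (Derives.subst Δ ih.1.2.1 hd.2)
    case substTermEq Γ t₁ t₂ T Δ t' T' =>
      refine ⟨ih.2.1.substCtx ih.1.2.2, ?_, Derives.subst Δ ih.1.2.2 hd.2⟩
      have h1 := substCtx_conv hd.1 Δ ih.2.1 [] _ (Derives.subst Δ ih.1.2.1 hd.2)
      exact .rule2 (.termConv _ _ _ _) (.rule2 (.substTypeEq Γ t₁ t₂ T Δ T') hd.1 ih.2.2) h1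

theorem Derives.ctxDer {Γ : List (Expr W)} {b} (h : Derives Λ ⟨Γ, b⟩) : CtxDer Λ Γ := h.presup'.1

/-- The boundary of a derivable judgement is derivable. -/
theorem Derives.presup {J : Judgement W} (h : Derives Λ J) : ∀ K ∈ J.boundary, Derives Λ K := by
  have hp := h.presup'
  match J with
  | ⟨[], .type _⟩ => simp [Judgement.boundary]
  | ⟨T :: Γ, .type _⟩ => simpa [Judgement.boundary] using hp.1.head
  | ⟨Γ, .term _ T⟩ => simpa [Judgement.boundary, Body.pre] using hp.2
  | ⟨Γ, .typeEq T T'⟩ => simpa [Judgement.boundary, Body.pre] using hp.2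
  | ⟨Γ, .termEq t t' T⟩ => simpa [Judgement.boundary, Body.pre] using hp.2


/-! ### Equality of contexts -/

/-- Contexts of the same length whose types are successively derivably equal. -/
inductive CtxEq (Λ : Set (Judgement W)) : List (Expr W) → List (Expr W) → Prop
  | nil : CtxEq Λ [] []
  | cons {Γ Γ' T T'} : CtxEq Λ Γ Γ' → Derives Λ ⟨Γ, .typeEq T T'⟩ → CtxEq Λ (T :: Γ) (T' :: Γ')

theorem CtxEq.derives {Γ Γ' : List (Expr W)} (h : CtxEq Λ Γ Γ') :
    ∀ (Δ : List (Expr W)) (b), Derives Λ ⟨Δ ++ Γ, b⟩ → Derives Λ ⟨Δ ++ Γ', b⟩ := by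
  induction h with
  | nil => exact fun _ _ h => h
  | @cons Γ Γ' T T' _ hT ih =>
    intro Δ b hb
    simpa using ih (Δ ++ [T']) b (by simpa using Derives.ctxConv Δ hT hb)

theorem CtxEq.refl {Γ : List (Expr W)} (h : CtxDer Λ Γ) : CtxEq Λ Γ Γ := by
  induction Γ with
  | nil => exact .nil
  | cons T Γ ih => exact .cons (ih h.tail) (.rule1 (.typeRefl Γ T) h.head)

theorem CtxEq.symm {Γ Γ' : List (Expr W)} (h : CtxEq Λ Γ Γ') : CtxEq Λ Γ' Γ := by
  induction h with
  | nil => exact .nil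
  | @cons Γ Γ' T T' h hT ih => exact .cons ih (.rule1 (.typeSymm _ _ _) (h.derives [] _ hT))

theorem CtxEq.trans {Γ Γ' Γ'' : List (Expr W)} (h : CtxEq Λ Γ Γ') (h' : CtxEq Λ Γ' Γ'') :
    CtxEq Λ Γ Γ'' := by
  induction h generalizing Γ'' with
  | nil => exact h'
  | @cons Γ Γ' T T' h hT ih =>
    cases h' with
    | cons h' hT' => exact .cons (ih h') (.rule2 (.typeTrans _ _ _ _) hT (h.symm.derives [] _ hT'))

theorem CtxEq.length_eq {Γ Γ' : List (Expr W)} (h : CtxEq Λ Γ Γ') : Γ.length = Γ'.length := by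
  induction h with
  | nil => rfl
  | cons _ _ ih => simp [ih]

/-- Provable equality `≡` of type judgements and of term judgements. -/
def Congr (Λ : Set (Judgement W)) : Judgement W → Judgement W → Prop
  | ⟨Γ, .type T⟩, ⟨Γ', .type T'⟩ => CtxEq Λ (T :: Γ) (T' :: Γ')
  | ⟨Γ, .term t T⟩, ⟨Γ', .term t' T'⟩ =>
      CtxEq Λ (T :: Γ) (T' :: Γ') ∧ Derives Λ ⟨Γ, .termEq t t' T⟩
  | _, _ => False

/-- Being a type judgement or a term judgement. -/
def Judgement.IsTypeOrTerm (J : Judgement W) : Prop :=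
  J.body.form = .type ∨ J.body.form = .term

theorem Congr.refl {J : Judgement W} (hJ : Derives Λ J) (h : J.IsTypeOrTerm) : Congr Λ J J := by
  match J, hJ, h with
  | ⟨Γ, .type T⟩, hJ, _ => exact CtxEq.refl (hJ.ctxDer.cons hJ)
  | ⟨Γ, .term t T⟩, hJ, _ =>
    have := hJ.presup'
    simp only [Body.pre, List.mem_singleton, forall_eq] at this
    exact ⟨CtxEq.refl (this.1.cons this.2), .rule1 (.termRefl _ _ _) hJ⟩
  | ⟨Γ, .typeEq _ _⟩, _, h => simp [Judgement.IsTypeOrTerm, Body.form] at h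
  | ⟨Γ, .termEq _ _ _⟩, _, h => simp [Judgement.IsTypeOrTerm, Body.form] at h

theorem Congr.symm {J K : Judgement W} (h : Congr Λ J K) : Congr Λ K J := by
  match J, K, h with
  | ⟨Γ, .type T⟩, ⟨Γ', .type T'⟩, h => exact CtxEq.symm h
  | ⟨Γ, .term t T⟩, ⟨Γ', .term t' T'⟩, ⟨h, h'⟩ =>
    cases h with
    | cons h hT =>
      exact ⟨(CtxEq.cons h hT).symm, h.derives [] _
        (.rule2 (.termEqConv _ _ _ _ _) hT (.rule1 (.termSymm _ _ _ _) h'))⟩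

theorem Congr.trans {J K L : Judgement W} (h : Congr Λ J K) (h' : Congr Λ K L) :
    Congr Λ J L := by
  match J, K, L, h, h' with
  | ⟨Γ, .type T⟩, ⟨Γ', .type T'⟩, ⟨Γ'', .type T''⟩, h, h' => exact CtxEq.trans h h'
  | ⟨Γ, .term t T⟩, ⟨Γ', .term t' T'⟩, ⟨Γ'', .term t'' T''⟩, ⟨h, ht⟩, ⟨h', ht'⟩ =>
    refine ⟨h.trans h', ?_⟩
    cases h with
    | cons h hT =>
      exact .rule2 (.termTrans _ _ _ _ _) ht (h.symm.derives [] _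
        (.rule2 (.termEqConv _ _ _ _ _) (.rule1 (.typeSymm _ _ _) (h.derives [] _ hT)) ht'))

/-- The single member of the boundary of a term judgement or of a type judgement of degree
at least two. -/
def Judgement.bd : Judgement W → Judgement W
  | ⟨Γ, .term _ T⟩ => ⟨Γ, .type T⟩
  | ⟨T :: Γ, .type _⟩ => ⟨Γ, .type T⟩
  | J => J

theorem Congr.bd {J K : Judgement W} (h : Congr Λ J K) (h' : J.body.form = .term ∨ J.ctx ≠ []) :
    Congr Λ J.bd K.bd := by
  match J, K, h with
  | ⟨[], .type T⟩, ⟨Γ', .type T'⟩, h => simp [Body.form] at h'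
  | ⟨S :: Γ, .type T⟩, ⟨[], .type T'⟩, h => cases h with | cons h _ => cases h
  | ⟨S :: Γ, .type T⟩, ⟨S' :: Γ', .type T'⟩, h => cases h with | cons h _ => exact h
  | ⟨Γ, .term t T⟩, ⟨Γ', .term t' T'⟩, h => exact h.1

end

/-! ## Generalised algebraic theories with the substitution rules -/

/-- The expression `w(x₀, …, xₙ₋₁)`. -/
def Expr.generic {W : Type u} (w : W) (n : ℕ) : Expr W := .app w n fun i => .var i

/-- A generalised algebraic theory with the equality and substitution rules only: type-constants
`Ω`, term-constants `Σ` (here `Con`), and basic judgements `Λ`, which are derivable. -/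
structure GAT : Type (u + 1) where
  Ω : Type u
  Con : Type u
  Λ : Set (Judgement (Ω ⊕ Con))
  existsUnique_type (A : Ω) :
    ∃! J, J ∈ Λ ∧ J.body = .type (.generic (.inl A) J.ctx.length)
  existsUnique_term (f : Con) :
    ∃! J, J ∈ Λ ∧ ∃ T, J.body = .term (.generic (.inr f) J.ctx.length) T
  basic (J) : J ∈ Λ →
    (∃ A, J.body = .type (.generic (.inl A) J.ctx.length)) ∨
    (∃ f T, J.body = .term (.generic (.inr f) J.ctx.length) T) ∨
    J.body.form = .typeEq ∨ J.body.form = .termEq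
  derives (J) : J ∈ Λ → Derives Λ J

namespace GAT

/-- The derived judgements of a theory. -/
abbrev Derived (T : GAT.{u}) : Type u := {J : Judgement (T.Ω ⊕ T.Con) // Derives T.Λ J}

/-- The boundary of a derived judgement, as a list of derived judgements. -/
def boundary (T : GAT.{u}) (J : T.Derived) : List T.Derived :=
  J.1.boundary.pmap Subtype.mk J.2.presup

/-- An interpretation: an assignment on derived judgements that preserves the form of judgements,
their boundaries, and the instances of the deduction rules. -/
structure Interp (T U : GAT.{u}) : Type u where
  toFun : T.Derived → U.Derived
  map_form (J) : (toFun J).1.body.form = J.1.body.form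
  map_boundary (J) : U.boundary (toFun J) = (T.boundary J).map toFun
  map_rule (r) (Js : List T.Derived) (J : T.Derived) :
    Rule r (Js.map Subtype.val) J.1 →
      Rule r ((Js.map toFun).map Subtype.val) (toFun J).1

namespace Interp

variable {T U V : GAT.{u}}

/-- The identity interpretation. -/
def id (T : GAT.{u}) : Interp T T where
  toFun J := J
  map_form _ := rfl
  map_boundary _ := by simp
  map_rule _ _ _ h := by simpa using h

/-- Composition of interpretations. -/
def comp (φ : Interp T U) (ψ : Interp U V) : Interp T V where
  toFun J := ψ.toFun (φ.toFun J)
  map_form J := (ψ.map_form _).trans (φ.map_form _)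
  map_boundary J := by rw [ψ.map_boundary, φ.map_boundary, List.map_map]; rfl
  map_rule r Js J h := by
    have := ψ.map_rule _ _ _ (φ.map_rule r Js J h)
    rw [List.map_map] at this ⊢
    rwa [List.map_map] at this

theorem val_boundary (φ : Interp T U) (J : T.Derived) :
    (φ.toFun J).1.boundary = J.1.boundary.pmap (fun K h => (φ.toFun ⟨K, h⟩).1) J.2.presup := by
  have := congrArg (List.map Subtype.val) (φ.map_boundary J)
  rw [boundary, boundary, List.map_map, List.map_pmap, List.map_pmap] at this
  simpa using this

theorem map_type_nil (φ : Interp T U) {A} (h : Derives T.Λ ⟨[], .type A⟩) :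
    ∃ B, (φ.toFun ⟨_, h⟩).1 = ⟨[], .type B⟩ := by
  have hf := φ.map_form ⟨_, h⟩
  have hb := φ.val_boundary ⟨_, h⟩
  revert hf hb
  generalize (φ.toFun ⟨_, h⟩).1 = K
  rcases K with ⟨_ | ⟨S, Δ⟩, _ | _ | _ | _⟩ <;> simp [Body.form, Judgement.boundary]

theorem map_type_cons (φ : Interp T U) {A S Γ} (h : Derives T.Λ ⟨S :: Γ, .type A⟩) :
    ∃ B S' Δ, (φ.toFun ⟨_, h⟩).1 = ⟨S' :: Δ, .type B⟩ ∧
      (φ.toFun ⟨_, h.ctxDer.head⟩).1 = ⟨Δ, .type S'⟩ := by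
  have hf := φ.map_form ⟨_, h⟩
  have hb := φ.val_boundary ⟨_, h⟩
  revert hf hb
  generalize (φ.toFun ⟨_, h⟩).1 = K
  rcases K with ⟨_ | ⟨S, Δ⟩, _ | _ | _ | _⟩ <;> simp [Body.form, Judgement.boundary]
  intro h; exact h.symm

theorem map_term (φ : Interp T U) {t A Γ} (h : Derives T.Λ ⟨Γ, .term t A⟩) :
    ∃ s B Δ, (φ.toFun ⟨_, h⟩).1 = ⟨Δ, .term s B⟩ ∧
      (φ.toFun ⟨⟨Γ, .type A⟩, h.presup _ (by simp [Judgement.boundary])⟩).1 = ⟨Δ, .type B⟩ := by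
  have hf := φ.map_form ⟨_, h⟩
  have hb := φ.val_boundary ⟨_, h⟩
  revert hf hb
  generalize (φ.toFun ⟨_, h⟩).1 = K
  rcases K with ⟨Δ, _ | _ | _ | _⟩ <;> simp [Body.form, Judgement.boundary]
  intro h; exact h.symm

theorem map_typeEq (φ : Interp T U) {A A' Γ} (h : Derives T.Λ ⟨Γ, .typeEq A A'⟩) :
    ∃ B B' Δ, (φ.toFun ⟨_, h⟩).1 = ⟨Δ, .typeEq B B'⟩ ∧
      (φ.toFun ⟨⟨Γ, .type A⟩, h.presup _ (by simp [Judgement.boundary])⟩).1 = ⟨Δ, .type B⟩ ∧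
      (φ.toFun ⟨⟨Γ, .type A'⟩, h.presup _ (by simp [Judgement.boundary])⟩).1
        = ⟨Δ, .type B'⟩ := by
  have hf := φ.map_form ⟨_, h⟩
  have hb := φ.val_boundary ⟨_, h⟩
  revert hf hb
  generalize (φ.toFun ⟨_, h⟩).1 = K
  rcases K with ⟨Δ, _ | _ | _ | _⟩ <;> simp [Body.form, Judgement.boundary]
  intro h h'; exact ⟨h.symm, h'.symm⟩

theorem map_termEq (φ : Interp T U) {t t' A Γ} (h : Derives T.Λ ⟨Γ, .termEq t t' A⟩) :
    ∃ s s' B Δ, (φ.toFun ⟨_, h⟩).1 = ⟨Δ, .termEq s s' B⟩ ∧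
      (φ.toFun ⟨⟨Γ, .term t A⟩, h.presup _ (by simp [Judgement.boundary])⟩).1 = ⟨Δ, .term s B⟩ ∧
      (φ.toFun ⟨⟨Γ, .term t' A⟩, h.presup _ (by simp [Judgement.boundary])⟩).1
        = ⟨Δ, .term s' B⟩ := by
  have hf := φ.map_form ⟨_, h⟩
  have hb := φ.val_boundary ⟨_, h⟩
  revert hf hb
  generalize (φ.toFun ⟨_, h⟩).1 = K
  rcases K with ⟨Δ, _ | _ | _ | _⟩ <;> simp [Body.form, Judgement.boundary]
  intro h h'; exact ⟨h.symm, h'.symm⟩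

theorem map_body_eq (φ : Interp T U) {Γ Γ'} (h : CtxEq T.Λ Γ Γ') :
    ∀ Δ b (hb : Derives T.Λ ⟨Δ ++ Γ, b⟩) (hb' : Derives T.Λ ⟨Δ ++ Γ', b⟩),
      (φ.toFun ⟨_, hb⟩).1.body = (φ.toFun ⟨_, hb'⟩).1.body := by
  induction h with
  | nil => exact fun _ _ _ _ => rfl
  | @cons Γ Γ' S S' h hS ih =>
    intro Δ b hb hb'
    have h1 : Derives T.Λ ⟨Δ ++ S' :: Γ, b⟩ := .ctxConv Δ hS hb
    have e1 := φ.map_rule .ctxConv [⟨_, hS⟩, ⟨_, hb⟩] ⟨_, h1⟩ (.ctxConv Γ S S' Δ b)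
    have e2 : (φ.toFun ⟨_, hb⟩).1.body = (φ.toFun ⟨_, h1⟩).1.body := by
      revert e1
      simp only [List.map]
      generalize (φ.toFun ⟨_, hS⟩).1 = M
      generalize (φ.toFun ⟨_, hb⟩).1 = K
      generalize (φ.toFun ⟨_, h1⟩).1 = L
      intro h; cases h; rfl
    rw [e2]
    have := ih (Δ ++ [S']) b (by simpa using h1) (by simpa using hb')
    simpa using this

theorem map_ctxEq (φ : Interp T U) {Γ Γ'} (h : CtxEq T.Λ Γ Γ') :
    ∀ {A A'} (_ : Derives T.Λ ⟨Γ, .typeEq A A'⟩) (hA : Derives T.Λ ⟨Γ, .type A⟩)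
      (hA' : Derives T.Λ ⟨Γ', .type A'⟩),
      Congr U.Λ (φ.toFun ⟨_, hA⟩).1 (φ.toFun ⟨_, hA'⟩).1 := by
  induction h with
  | nil =>
    intro A A' hAA hA hA'
    obtain ⟨B, B', Δ, e, e1, e2⟩ := φ.map_typeEq hAA
    obtain ⟨C, e3⟩ := φ.map_type_nil hA
    have hd := (φ.toFun ⟨_, hAA⟩).2
    rw [e] at hd
    rw [e1] at e3
    cases e3
    rw [e1, e2]
    exact .cons .nil hd
  | @cons Γ Γ' S S' h hS ih =>
    intro A A' hAA hA hA'
    obtain ⟨B, B', Δ, e, e1, e2⟩ := φ.map_typeEq hAA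
    obtain ⟨C, D, Ξ, e3, e4⟩ := φ.map_type_cons hA
    obtain ⟨C', D', Ξ', e5, e6⟩ := φ.map_type_cons hA'
    have hd := (φ.toFun ⟨_, hAA⟩).2
    rw [e] at hd
    have ih' := ih hS hA.ctxDer.head hA'.ctxDer.head
    rw [e4, e6] at ih'
    have hA'' : Derives T.Λ ⟨S :: Γ, .type A'⟩ := hAA.presup _ (by simp [Judgement.boundary])
    have hbody := φ.map_body_eq (.cons h hS) [] _ hA'' hA'
    simp only [List.nil_append] at hbody
    rw [e2, e5] at hbody
    cases hbody
    rw [e1] at e3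
    cases e3
    rw [e1, e5]
    exact .cons ih' hd

/-- Interpretations preserve provable equality. -/
theorem map_congr (φ : Interp T U) (J K : T.Derived) (h : Congr T.Λ J.1 K.1) :
    Congr U.Λ (φ.toFun J).1 (φ.toFun K).1 := by
  match J, K, h with
  | ⟨⟨Γ, .type A⟩, hJ⟩, ⟨⟨Γ', .type A'⟩, hK⟩, h =>
    cases h with
    | cons h hA => exact φ.map_ctxEq h hA hJ hK
  | ⟨⟨Γ, .term t A⟩, hJ⟩, ⟨⟨Γ', .term t' A'⟩, hK⟩, ⟨h, ht⟩ =>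
    obtain ⟨s, s', B, Δ, e, e1, e2⟩ := φ.map_termEq ht
    obtain ⟨_, _, _, e3, e4⟩ := φ.map_term hJ
    obtain ⟨u, B', Δ', e5, e6⟩ := φ.map_term hK
    rw [e1] at e3
    cases e3
    have hd := (φ.toFun ⟨_, ht⟩).2
    rw [e] at hd
    cases h with
    | cons h hA =>
      have h1 := φ.map_ctxEq h hA (hJ.presup _ (by simp [Judgement.boundary]))
        (hK.presup _ (by simp [Judgement.boundary]))
      rw [e4, e6] at h1
      rw [e1, e5]
      have ht' : Derives T.Λ ⟨Γ, .term t' A⟩ := ht.presup _ (by simp [Judgement.boundary])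
      have ht'' : Derives T.Λ ⟨Γ, .term t' A'⟩ := .rule2 (.termConv _ _ _ _) hA ht'
      have r1 := φ.map_rule .termConv [⟨_, hA⟩, ⟨_, ht'⟩] ⟨_, ht''⟩ (.termConv _ _ _ _)
      have hb := φ.map_body_eq h [] _ ht'' hK
      simp only [List.nil_append, List.map] at hb r1
      rw [e5] at hb
      rw [e2] at r1
      revert r1 hb
      generalize (φ.toFun ⟨_, hA⟩).1 = K1
      generalize (φ.toFun ⟨_, ht''⟩).1 = K2
      intro r1 hb
      cases r1
      cases hb
      exact ⟨h1, hd⟩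

/-- Two interpretations are identified if they agree, up to provable equality, on each derived
type or term judgement. -/
instance setoid (T U : GAT.{u}) : Setoid (Interp T U) where
  r φ ψ := ∀ J : T.Derived, J.1.IsTypeOrTerm → Congr U.Λ (φ.toFun J).1 (ψ.toFun J).1
  iseqv :=
    { refl := fun φ J hJ => Congr.refl (φ.toFun J).2 (by
        simpa only [Judgement.IsTypeOrTerm, φ.map_form] using hJ)
      symm := fun h J hJ => (h J hJ).symm
      trans := fun h h' J hJ => (h J hJ).trans (h' J hJ) }

theorem comp_equiv {φ φ' : Interp T U} {ψ ψ' : Interp U V} (h : φ ≈ φ') (h' : ψ ≈ ψ') :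
    φ.comp ψ ≈ φ'.comp ψ' := fun J hJ =>
  (ψ.map_congr _ _ (h J hJ)).trans (h' _ (by
    simpa only [Judgement.IsTypeOrTerm, φ'.map_form] using hJ))

end Interp

/-- The category of generalised algebraic theories with the substitution rules. -/
instance : Category GAT.{u} where
  Hom T U := Quotient (Interp.setoid T U)
  id T := Quotient.mk _ (Interp.id T)
  comp f g := Quotient.map₂ Interp.comp (fun _ _ h _ _ h' => Interp.comp_equiv h h') f g
  id_comp f := by induction f using Quotient.ind; rfl
  comp_id f := by induction f using Quotient.ind; rfl
  assoc f g h := by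
    induction f using Quotient.ind
    induction g using Quotient.ind
    induction h using Quotient.ind
    rfl

end GAT

/-! ## Type-and-term structures -/

/-- The vertices of the graph that generates `ℍ`: `ty n` and `tm n` are the objects `n + 1` and
`(n + 1)_t`, so that the degree is one more than the index. -/
inductive Vertex
  | ty (n : ℕ)
  | tm (n : ℕ)

/-- The edges of the graph that generates `ℍ`. -/
inductive Edge : Vertex → Vertex → Type
  | next (n : ℕ) : Edge (.ty n) (.ty (n + 1))
  | term (n : ℕ) : Edge (.ty n) (.tm n)

instance : Quiver Vertex := ⟨Edge⟩

/-- The category `ℍ`, freely generated by the graph. -/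
abbrev HCat : Type := Paths Vertex

/-- The category of type-and-term structures: presheaves on `ℍ`. -/
abbrev Struct : Type (u + 1) := HCatᵒᵖ ⥤ Type u

namespace Struct

/-- The type-elements of degree `n + 1`. -/
abbrev Ty (X : Struct.{u}) (n : ℕ) : Type u := X.obj (op ((Paths.of Vertex).obj (.ty n)))

/-- The term-elements of degree `n + 1`. -/
abbrev Tm (X : Struct.{u}) (n : ℕ) : Type u := X.obj (op ((Paths.of Vertex).obj (.tm n)))

/-- The boundary of a type-element. -/
def bdTy (X : Struct.{u}) {n : ℕ} (A : X.Ty (n + 1)) : X.Ty n :=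
  X.map ((Paths.of Vertex).map (Edge.next n)).op A

/-- The boundary of a term-element. -/
def bdTm (X : Struct.{u}) {n : ℕ} (a : X.Tm n) : X.Ty n :=
  X.map ((Paths.of Vertex).map (Edge.term n)).op a

/-- The set of term-elements with boundary `A`. -/
def TmOver (X : Struct.{u}) {n : ℕ} (A : X.Ty n) : Type u := {a : X.Tm n // X.bdTm a = A}

section
variable (Ty Tm : ℕ → Type u) (bdTy : ∀ n, Ty (n + 1) → Ty n) (bdTm : ∀ n, Tm n → Ty n)

/-- The sets of a type-and-term structure. -/
def mkObj : Vertex → Type u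
  | .ty n => Ty n
  | .tm n => Tm n

/-- The generating maps of a type-and-term structure. -/
def mkMap : ∀ {v w : Vertex}, Edge v w → mkObj Ty Tm w → mkObj Ty Tm v
  | _, _, .next n => bdTy n
  | _, _, .term n => bdTm n

/-- The type-and-term structure with given type-elements, term-elements and boundary maps. -/
def mk : Struct.{u} :=
  (Paths.lift (C := (Type u)ᵒᵖ)
    { obj := fun v => op (mkObj Ty Tm v)
      map := fun {_ _} e => (TypeCat.ofHom (mkMap Ty Tm bdTy bdTm e)).op }).leftOp

end

section
variable (Ty Tm : ℕ → Type u) (bT : ∀ n, Ty (n + 1) → Ty n) (bt : ∀ n, Tm n → Ty n)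

theorem mk_bdTy {n} (A : (mk Ty Tm bT bt).Ty (n + 1)) : (mk Ty Tm bT bt).bdTy A = bT n A := rfl

theorem mk_bdTm {n} (A : (mk Ty Tm bT bt).Tm n) : (mk Ty Tm bT bt).bdTm A = bt n A := rfl
end

/-- The action of a map of type-and-term structures on type-elements. -/
def mapTy {X Y : Struct.{u}} (f : X ⟶ Y) {n : ℕ} (A : X.Ty n) : Y.Ty n := f.app _ A

/-- The action of a map of type-and-term structures on term-elements. -/
def mapTm {X Y : Struct.{u}} (f : X ⟶ Y) {n : ℕ} (a : X.Tm n) : Y.Tm n := f.app _ a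

theorem bdTy_mapTy {X Y : Struct.{u}} (f : X ⟶ Y) {n : ℕ} (A : X.Ty (n + 1)) :
    Y.bdTy (mapTy f A) = mapTy f (X.bdTy A) :=
  (ConcreteCategory.congr_hom (f.naturality ((Paths.of Vertex).map (Edge.next n)).op) A).symm

theorem bdTm_mapTm {X Y : Struct.{u}} (f : X ⟶ Y) {n : ℕ} (a : X.Tm n) :
    Y.bdTm (mapTm f a) = mapTy f (X.bdTm a) :=
  (ConcreteCategory.congr_hom (f.naturality ((Paths.of Vertex).map (Edge.term n)).op) a).symm

/-- A map of type-and-term structures from its action on type-elements and term-elements. -/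
def homMk {X Y : Struct.{u}} (f : ∀ n, X.Ty n → Y.Ty n) (g : ∀ n, X.Tm n → Y.Tm n)
    (hf : ∀ n (A : X.Ty (n + 1)), Y.bdTy (f (n + 1) A) = f n (X.bdTy A))
    (hg : ∀ n (a : X.Tm n), Y.bdTm (g n a) = f n (X.bdTm a)) : X ⟶ Y where
  app v := match v with
    | ⟨.ty n⟩ => TypeCat.ofHom (f n)
    | ⟨.tm n⟩ => TypeCat.ofHom (g n)
  naturality := by
    rintro ⟨v⟩ ⟨w⟩ p
    obtain ⟨p, rfl⟩ : ∃ q : w ⟶ v, p = q.op := ⟨p.unop, rfl⟩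
    induction p using Paths.induction with
    | id => simp
    | comp p e ih =>
      rw [op_comp, Functor.map_comp, Functor.map_comp, Category.assoc, ih, ← Category.assoc,
        ← Category.assoc]
      congr 1
      match v, w, e with
      | _, _, .next n => ext A; exact (hf n A).symm
      | _, _, .term n => ext A; exact (hg n A).symm

theorem hom_ext {X Y : Struct.{u}} {f g : X ⟶ Y} (h : ∀ n (A : X.Ty n), mapTy f A = mapTy g A)
    (h' : ∀ n (a : X.Tm n), mapTm f a = mapTm g a) : f = g := by
  ext ⟨v⟩ x
  match v, x with
  | .ty n, x => exact h n x
  | .tm n, x => exact h' n x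

end Struct

/-! ## The forgetful functor -/

namespace GAT

theorem derives_bd {W : Type u} {Λ : Set (Judgement W)} {J : Judgement W} (h : Derives Λ J) :
    Derives Λ J.bd := by
  match J, h with
  | ⟨Γ, .term t A⟩, h => exact h.presup _ (by simp [Judgement.boundary, Judgement.bd])
  | ⟨[], .type A⟩, h => exact h
  | ⟨S :: Γ, .type A⟩, h => exact h.presup _ (by simp [Judgement.boundary, Judgement.bd])
  | ⟨Γ, .typeEq A B⟩, h => exact h
  | ⟨Γ, .termEq s t A⟩, h => exact h

/-- The derived judgements of degree `n + 1` of a given form. -/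
def Judg (T : GAT.{u}) (f : Form) (n : ℕ) : Type u :=
  {J : T.Derived // J.1.body.form = f ∧ J.1.degree = n + 1}

/-- Provable equality on the derived type judgements of a given degree. -/
instance typeSetoid (T : GAT.{u}) (n : ℕ) : Setoid (T.Judg .type n) where
  r J K := Congr T.Λ J.1.1 K.1.1
  iseqv := ⟨fun J => .refl J.1.2 (.inl J.2.1), .symm, .trans⟩

/-- Provable equality on the derived term judgements of a given degree. -/
instance termSetoid (T : GAT.{u}) (n : ℕ) : Setoid (T.Judg .term n) where
  r J K := Congr T.Λ J.1.1 K.1.1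
  iseqv := ⟨fun J => .refl J.1.2 (.inr J.2.1), .symm, .trans⟩

theorem bd_type_spec {W : Type u} {J : Judgement W} {n : ℕ} (h : J.body.form = .type)
    (h' : J.degree = n + 1 + 1) : J.bd.body.form = .type ∧ J.bd.degree = n + 1 := by
  match J, h, h' with
  | ⟨[], .type A⟩, _, h' => simp [Judgement.degree] at h'
  | ⟨S :: Γ, .type A⟩, _, h' => exact ⟨rfl, by simpa [Judgement.degree, Judgement.bd] using h'⟩

theorem bd_term_spec {W : Type u} {J : Judgement W} {n : ℕ} (h : J.body.form = .term)
    (h' : J.degree = n + 1) : J.bd.body.form = .type ∧ J.bd.degree = n + 1 := by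
  match J, h, h' with
  | ⟨Γ, .term t A⟩, _, h' => exact ⟨rfl, h'⟩

/-- The boundary of a type judgement of degree `n + 2`. -/
def judgBdTy (T : GAT.{u}) (n : ℕ) (J : T.Judg .type (n + 1)) : T.Judg .type n :=
  ⟨⟨J.1.1.bd, derives_bd J.1.2⟩, bd_type_spec J.2.1 J.2.2⟩

/-- The boundary of a term judgement. -/
def judgBdTm (T : GAT.{u}) (n : ℕ) (J : T.Judg .term n) : T.Judg .type n :=
  ⟨⟨J.1.1.bd, derives_bd J.1.2⟩, bd_term_spec J.2.1 J.2.2⟩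

/-- The type-and-term structure of derived type and term judgements modulo provable equality. -/
def toStruct (T : GAT.{u}) : Struct.{u} :=
  Struct.mk (fun n => Quotient (T.typeSetoid n)) (fun n => Quotient (T.termSetoid n))
    (fun n => Quotient.map (T.judgBdTy n) fun J K h => Congr.bd h (.inr fun h0 => by
      have := J.2.2; simp [Judgement.degree, h0] at this))
    (fun n => Quotient.map (T.judgBdTm n) fun J _ h => Congr.bd h (.inl J.2.1))

/-- The type-element represented by a type judgement. -/
def tyMk (T : GAT.{u}) {n : ℕ} (J : T.Judg .type n) : T.toStruct.Ty n := Quotient.mk (T.typeSetoid n) J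

/-- The term-element represented by a term judgement. -/
def tmMk (T : GAT.{u}) {n : ℕ} (J : T.Judg .term n) : T.toStruct.Tm n := Quotient.mk (T.termSetoid n) J

theorem tyMk_surj (T : GAT.{u}) {n : ℕ} (A : T.toStruct.Ty n) : ∃ J, T.tyMk J = A :=
  Quotient.exists_rep (s := T.typeSetoid n) A

theorem tmMk_surj (T : GAT.{u}) {n : ℕ} (A : T.toStruct.Tm n) : ∃ J, T.tmMk J = A :=
  Quotient.exists_rep (s := T.termSetoid n) A

theorem tyMk_eq {T : GAT.{u}} {n : ℕ} {J K : T.Judg .type n} :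
    T.tyMk J = T.tyMk K ↔ Congr T.Λ J.1.1 K.1.1 :=
  Quotient.eq (r := T.typeSetoid n)

theorem tmMk_eq {T : GAT.{u}} {n : ℕ} {J K : T.Judg .term n} :
    T.tmMk J = T.tmMk K ↔ Congr T.Λ J.1.1 K.1.1 :=
  Quotient.eq (r := T.termSetoid n)

theorem bdTy_tyMk (T : GAT.{u}) {n : ℕ} (J : T.Judg .type (n + 1)) :
    T.toStruct.bdTy (T.tyMk J) = T.tyMk (T.judgBdTy n J) := rfl

theorem bdTm_tmMk (T : GAT.{u}) {n : ℕ} (J : T.Judg .term n) :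
    T.toStruct.bdTm (T.tmMk J) = T.tyMk (T.judgBdTm n J) := rfl

namespace Interp
variable {T U V : GAT.{u}}

theorem map_bd (φ : Interp T U) (J : T.Derived) (h : J.1.IsTypeOrTerm) :
    (φ.toFun J).1.bd = (φ.toFun ⟨J.1.bd, derives_bd J.2⟩).1 := by
  match J, h with
  | ⟨⟨Γ, .term t A⟩, hJ⟩, _ =>
    obtain ⟨s, B, Δ, e, e'⟩ := φ.map_term hJ
    rw [e]; exact e'.symm
  | ⟨⟨[], .type A⟩, hJ⟩, _ =>
    obtain ⟨B, e⟩ := φ.map_type_nil hJ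
    rw [e]; exact e.symm
  | ⟨⟨S :: Γ, .type A⟩, hJ⟩, _ =>
    obtain ⟨s, B, Δ, e, e'⟩ := φ.map_type_cons hJ
    rw [e]; exact e'.symm
  | ⟨⟨Γ, .typeEq _ _⟩, _⟩, h => simp [Judgement.IsTypeOrTerm, Body.form] at h
  | ⟨⟨Γ, .termEq _ _ _⟩, _⟩, h => simp [Judgement.IsTypeOrTerm, Body.form] at h

/-- Interpretations preserve degrees. -/
theorem map_degree (φ : Interp T U) (J : T.Derived) :
    (φ.toFun J).1.degree = J.1.degree := by
  have hty : ∀ (Γ : List (Expr (T.Ω ⊕ T.Con))) (A) (h : Derives T.Λ ⟨Γ, .type A⟩),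
      (φ.toFun ⟨_, h⟩).1.ctx.length = Γ.length := by
    intro Γ
    induction Γ with
    | nil =>
      intro A h
      obtain ⟨B, e⟩ := φ.map_type_nil h
      rw [e]; rfl
    | cons S Γ ih =>
      intro A h
      obtain ⟨s, B, Δ, e, e'⟩ := φ.map_type_cons h
      have := ih S h.ctxDer.head
      rw [e'] at this
      rw [e]; simpa using this
  unfold Judgement.degree
  match J with
  | ⟨⟨Γ, .type A⟩, h⟩ => rw [hty]
  | ⟨⟨Γ, .term t A⟩, h⟩ =>
    obtain ⟨s, B, Δ, e, e'⟩ := φ.map_term h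
    rw [← hty Γ A (h.presup _ (by simp [Judgement.boundary])), e, e']
  | ⟨⟨Γ, .typeEq A B⟩, h⟩ =>
    obtain ⟨_, _, Δ, e, e', _⟩ := φ.map_typeEq h
    rw [← hty Γ A (h.presup _ (by simp [Judgement.boundary])), e, e']
  | ⟨⟨Γ, .termEq s t A⟩, h⟩ =>
    obtain ⟨_, _, _, Δ, e, e', _⟩ := φ.map_termEq h
    have h' : Derives T.Λ ⟨Γ, .term s A⟩ := h.presup _ (by simp [Judgement.boundary])
    obtain ⟨_, _, _, e2, e3⟩ := φ.map_term h'
    rw [← hty Γ A (h'.presup _ (by simp [Judgement.boundary])), e, e3]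
    rw [e'] at e2
    cases e2
    rfl

/-- The action of an interpretation on judgements of a given form and degree. -/
def mapJudg (φ : Interp T U) {f : Form} {n : ℕ} (J : T.Judg f n) : U.Judg f n :=
  ⟨φ.toFun J.1, (φ.map_form _).trans J.2.1, (φ.map_degree _).trans J.2.2⟩

/-- The map of type-and-term structures given by an interpretation, `[𝒥] ↦ [φ(𝒥)]`. -/
def toStructHom (φ : Interp T U) : T.toStruct ⟶ U.toStruct :=
  Struct.homMk
    (fun n => Quotient.map (sa := T.typeSetoid n) (sb := U.typeSetoid n) φ.mapJudg
      fun J K h => φ.map_congr J.1 K.1 h)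
    (fun n => Quotient.map (sa := T.termSetoid n) (sb := U.termSetoid n) φ.mapJudg
      fun J K h => φ.map_congr J.1 K.1 h)
    (fun n A => by
      obtain ⟨J, rfl⟩ := T.tyMk_surj A
      exact congrArg U.tyMk (Subtype.ext (Subtype.ext (φ.map_bd J.1 (.inl J.2.1)))))
    (fun n a => by
      obtain ⟨J, rfl⟩ := T.tmMk_surj a
      exact congrArg U.tyMk (Subtype.ext (Subtype.ext (φ.map_bd J.1 (.inr J.2.1)))))

theorem mapTy_toStructHom (φ : Interp T U) {n} (J : T.Judg .type n) :
    Struct.mapTy φ.toStructHom (T.tyMk J) = U.tyMk (φ.mapJudg J) := rfl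

theorem mapTm_toStructHom (φ : Interp T U) {n} (J : T.Judg .term n) :
    Struct.mapTm φ.toStructHom (T.tmMk J) = U.tmMk (φ.mapJudg J) := rfl

theorem toStructHom_congr {φ ψ : Interp T U} (h : φ ≈ ψ) : φ.toStructHom = ψ.toStructHom := by
  apply Struct.hom_ext
  · intro n A
    obtain ⟨J, rfl⟩ := T.tyMk_surj A
    rw [mapTy_toStructHom, mapTy_toStructHom, tyMk_eq]
    exact h J.1 (.inl J.2.1)
  · intro n a
    obtain ⟨J, rfl⟩ := T.tmMk_surj a
    rw [mapTm_toStructHom, mapTm_toStructHom, tmMk_eq]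
    exact h J.1 (.inr J.2.1)

end Interp

/-- The forgetful functor from theories to type-and-term structures. -/
def forgetful : GAT.{u} ⥤ Struct.{u} where
  obj T := T.toStruct
  map f := Quotient.lift Interp.toStructHom (fun _ _ h => Interp.toStructHom_congr h) f
  map_id T := by
    change (Interp.id T).toStructHom = _
    apply Struct.hom_ext
    · intro n A
      obtain ⟨J, rfl⟩ := T.tyMk_surj A
      rfl
    · intro n A
      obtain ⟨J, rfl⟩ := T.tmMk_surj A
      rfl
  map_comp f g := by
    induction f using Quotient.ind with | _ φ
    induction g using Quotient.ind with | _ ψ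
    change (φ.comp ψ).toStructHom = φ.toStructHom ≫ ψ.toStructHom
    apply Struct.hom_ext
    · intro n A
      obtain ⟨J, rfl⟩ := GAT.tyMk_surj _ A
      rfl
    · intro n A
      obtain ⟨J, rfl⟩ := GAT.tmMk_surj _ A
      rfl

end GAT

/-! ## The free theory on a type-and-term structure -/

section Free
variable (X : Struct.{u})

/-- The alphabet of the free theory: the type-elements and the term-elements. -/
abbrev Alphabet : Type u := (Σ n, X.Ty n) ⊕ (Σ n, X.Tm n)

/-- The type expression `A(x₀, …, xₙ₋₁)`. -/
def genTy {n : ℕ} (A : X.Ty n) : Expr (Alphabet X) := .generic (.inl ⟨n, A⟩) n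

/-- The term expression `a(x₀, …, xₙ₋₁)`. -/
def genTm {n : ℕ} (a : X.Tm n) : Expr (Alphabet X) := .generic (.inr ⟨n, a⟩) n

/-- The context `x₀ : A₀, …, xₙ₋₁ : Aₙ₋₁(x₀, …, xₙ₋₂)` given by the successive boundaries
of a type-element. -/
def genCtx : ∀ {n : ℕ}, X.Ty n → List (Expr (Alphabet X))
  | 0, _ => []
  | _ + 1, A => genTy X (X.bdTy A) :: genCtx (X.bdTy A)

/-- The basic judgement of a type-element. -/
def genTyJ {n : ℕ} (A : X.Ty n) : Judgement (Alphabet X) := ⟨genCtx X A, .type (genTy X A)⟩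

/-- The basic judgement of a term-element. -/
def genTmJ {n : ℕ} (a : X.Tm n) : Judgement (Alphabet X) :=
  ⟨genCtx X (X.bdTm a), .term (genTm X a) (genTy X (X.bdTm a))⟩

/-- The basic judgements of the free theory. -/
def freeBasic : Set (Judgement (Alphabet X)) :=
  {J | (∃ (n : ℕ) (A : X.Ty n), J = genTyJ X A) ∨ ∃ (n : ℕ) (a : X.Tm n), J = genTmJ X a}

theorem length_genCtx : ∀ {n : ℕ} (A : X.Ty n), (genCtx X A).length = n
  | 0, _ => rfl
  | _ + 1, A => by simp [genCtx, length_genCtx (X.bdTy A)]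

theorem derives_genTyJ : ∀ {n : ℕ} (A : X.Ty n), Derives (freeBasic X) (genTyJ X A)
  | 0, A => .basic _ (.inl ⟨_, A, rfl⟩) (by simp [genTyJ, genCtx, Judgement.boundary])
  | n + 1, A => .basic _ (.inl ⟨_, A, rfl⟩) (by
      simpa [genTyJ, genCtx, Judgement.boundary] using derives_genTyJ (X.bdTy A))

theorem derives_genTmJ {n : ℕ} (a : X.Tm n) : Derives (freeBasic X) (genTmJ X a) :=
  .basic _ (.inr ⟨_, a, rfl⟩) (by
    simp only [genTmJ, Judgement.boundary, List.mem_singleton, forall_eq]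
    exact derives_genTyJ X (X.bdTm a))

/-- The free theory on a type-and-term structure. -/
def freeGAT : GAT.{u} where
  Ω := Σ n, X.Ty n
  Con := Σ n, X.Tm n
  Λ := freeBasic X
  existsUnique_type := by
    rintro ⟨n, A⟩
    refine ⟨genTyJ X A, ⟨.inl ⟨n, A, rfl⟩, by simp [genTyJ, genTy, length_genCtx]⟩, ?_⟩
    rintro J ⟨⟨m, B, rfl⟩ | ⟨m, b, rfl⟩, hJ⟩
    · simp only [genTyJ, genTy, Expr.generic, Body.type.injEq, Expr.app.injEq, Sum.inl.injEq] at hJ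
      obtain ⟨hJ, -⟩ := hJ
      cases hJ
      rfl
    · simp [genTmJ] at hJ
  existsUnique_term := by
    rintro ⟨n, a⟩
    refine ⟨genTmJ X a, ⟨.inr ⟨n, a, rfl⟩, _, by simp only [genTmJ, genTm, length_genCtx]; rfl⟩, ?_⟩
    rintro J ⟨⟨m, B, rfl⟩ | ⟨m, b, rfl⟩, T, hJ⟩
    · simp [genTyJ] at hJ
    · simp only [genTmJ, genTm, Expr.generic, Body.term.injEq, Expr.app.injEq, Sum.inr.injEq] at hJ
      obtain ⟨⟨hJ, -⟩, -⟩ := hJ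
      cases hJ
      rfl
  basic := by
    rintro J (⟨n, A, rfl⟩ | ⟨n, a, rfl⟩)
    · exact .inl ⟨⟨n, A⟩, by simp [genTyJ, genTy, length_genCtx]⟩
    · exact .inr (.inl ⟨⟨n, a⟩, genTy X (X.bdTm a), by simp [genTmJ, genTm, length_genCtx]⟩)
  derives := by
    rintro J (⟨n, A, rfl⟩ | ⟨n, a, rfl⟩)
    · exact derives_genTyJ X A
    · exact derives_genTmJ X a

/-- The basic judgement of a type-element, as a judgement of the free theory. -/
def genTyJudg {n : ℕ} (A : X.Ty n) : (freeGAT X).Judg .type n :=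
  ⟨⟨genTyJ X A, derives_genTyJ X A⟩, rfl, congrArg (· + 1) (length_genCtx X A)⟩

/-- The basic judgement of a term-element, as a judgement of the free theory. -/
def genTmJudg {n : ℕ} (a : X.Tm n) : (freeGAT X).Judg .term n :=
  ⟨⟨genTmJ X a, derives_genTmJ X a⟩, rfl, congrArg (· + 1) (length_genCtx X _)⟩

/-- The map sending each element to the class of its basic judgement. -/
def freeUnit : X ⟶ GAT.forgetful.obj (freeGAT X) :=
  Struct.homMk (Y := (freeGAT X).toStruct)
    (fun _ A => (freeGAT X).tyMk (genTyJudg X A))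
    (fun _ a => (freeGAT X).tmMk (genTmJudg X a))
    (fun _ _ => rfl)
    (fun _ _ => rfl)

end Free


/-! ### The universal property of the free theory -/

section Scope
variable {W : Type u}

/-- All variables are among the first `n`. -/
def Expr.Scoped (n : ℕ) : Expr W → Prop
  | .var i => i < n
  | .app _ _ args => ∀ i, (args i).Scoped n

/-- All variables are among the first `n`. -/
def Body.Scoped (n : ℕ) : Body W → Prop
  | .type T => T.Scoped n
  | .term t T => t.Scoped n ∧ T.Scoped n
  | .typeEq T T' => T.Scoped n ∧ T'.Scoped n
  | .termEq t t' T => t.Scoped n ∧ t'.Scoped n ∧ T.Scoped n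

theorem Expr.Scoped.mono {m n : ℕ} (h : m ≤ n) : ∀ {e : Expr W}, e.Scoped m → e.Scoped n
  | .var _, he => lt_of_lt_of_le he h
  | .app _ _ _, he => fun i => (he i).mono h

theorem Expr.Scoped.subst {m n : ℕ} {t : Expr W} (ht : t.Scoped m) (hmn : m ≤ n) :
    ∀ {e : Expr W}, e.Scoped (n + 1) → (e.subst m t).Scoped n
  | .var i, he => by
    simp only [Expr.Scoped] at he
    simp only [Expr.subst]
    split_ifs with h1 h2
    · exact lt_of_lt_of_le h1 hmn
    · exact ht.mono hmn
    · simp only [Expr.Scoped]; omega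
  | .app _ _ _, he => fun i => ht.subst hmn (he i)

theorem Body.Scoped.subst {m n : ℕ} {t : Expr W} (ht : t.Scoped m) (hmn : m ≤ n) {b : Body W}
    (h : b.Scoped (n + 1)) : (b.subst m t).Scoped n := by
  cases b with
  | type T => exact ht.subst hmn h
  | term t T => exact ⟨ht.subst hmn h.1, ht.subst hmn h.2⟩
  | typeEq T T' => exact ⟨ht.subst hmn h.1, ht.subst hmn h.2⟩
  | termEq t t' T => exact ⟨ht.subst hmn h.1, ht.subst hmn h.2.1, ht.subst hmn h.2.2⟩

/-- Simultaneous substitution. -/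
def Expr.bind (e : Expr W) (σ : ℕ → Expr W) : Expr W :=
  match e with
  | .var i => σ i
  | .app w n args => .app w n fun i => (args i).bind σ

theorem Expr.bind_congr {n : ℕ} {σ τ : ℕ → Expr W} (h : ∀ i < n, σ i = τ i) :
    ∀ {e : Expr W}, e.Scoped n → e.bind σ = e.bind τ
  | .var i, he => h i he
  | .app w m args, he => by
    simp only [Expr.bind]; congr 1; funext i; exact Expr.bind_congr h (he i)

theorem Expr.bind_var : ∀ (e : Expr W), e.bind .var = e
  | .var i => rfl
  | .app w m args => by
    simp only [Expr.bind]; congr 1; funext i; exact Expr.bind_var (args i)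

theorem Expr.subst_bind (k : ℕ) (t : Expr W) (σ : ℕ → Expr W) :
    ∀ (e : Expr W), (e.bind σ).subst k t = e.bind fun i => (σ i).subst k t
  | .var i => rfl
  | .app w m args => by
    simp only [Expr.bind, Expr.subst]; congr 1; funext i; exact Expr.subst_bind k t σ (args i)

end Scope

namespace GAT

theorem derives_scoped (T : GAT.{u}) {J} (h : Derives T.Λ J) : J.body.Scoped J.ctx.length := by
  induction h with
  | basic J hJ hb ih =>
    rcases J with ⟨Γ, T' | ⟨t, T'⟩ | ⟨T', T''⟩ | ⟨t, t', T'⟩⟩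
    · rcases T.basic _ hJ with ⟨A, h⟩ | ⟨f, T', h⟩ | h | h <;> simp [Body.form] at h
      subst h
      exact fun i => i.2
    · rcases T.basic _ hJ with ⟨A, h⟩ | ⟨f, T', h⟩ | h | h <;> simp [Body.form] at h
      obtain ⟨rfl, rfl⟩ := h
      simp [Judgement.boundary] at ih
      exact ⟨fun i => i.2, ih⟩
    · simp [Judgement.boundary] at ih
      exact ih
    · simp [Judgement.boundary] at ih
      exact ⟨ih.1.1, ih.2.1, ih.1.2⟩
  | rule r Js J hr hd ih =>
    have hsub : ∀ {Γ Δ : List (Expr (T.Ω ⊕ T.Con))} {S t : Expr (T.Ω ⊕ T.Con)},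
        (substCtx Δ Γ.length t ++ Γ).length + 1 = (Δ ++ S :: Γ).length := by
      intros; simp [substCtx]; omega
    have hle : ∀ {Γ Δ : List (Expr (T.Ω ⊕ T.Con))} {t : Expr (T.Ω ⊕ T.Con)},
        Γ.length ≤ (substCtx Δ Γ.length t ++ Γ).length := by
      intros; simp
    cases hr <;>
      simp only [List.mem_cons, List.not_mem_nil, or_false, forall_eq_or_imp, forall_eq] at ih
    case termRefl => exact ⟨ih.1, ih.1, ih.2⟩
    case termSymm => exact ⟨ih.2.1, ih.1, ih.2.2⟩
    case termTrans => exact ⟨ih.1.1, ih.2.2.1, ih.1.2.2⟩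
    case typeRefl => exact ⟨ih, ih⟩
    case typeSymm => exact ⟨ih.2, ih.1⟩
    case typeTrans => exact ⟨ih.1.1, ih.2.2⟩
    case termConv => exact ⟨ih.2.1, ih.1.2⟩
    case termEqConv => exact ⟨ih.2.1, ih.2.2.1, ih.1.2⟩
    case ctxConv => simpa using ih.2
    case subst Γ t S Δ b =>
      exact Body.Scoped.subst ih.1.1 hle (by rw [hsub]; exact ih.2)
    case substTypeEq Γ t₁ t₂ S Δ S' =>
      exact ⟨ih.1.1.subst hle (by rw [hsub]; exact ih.2),
        ih.1.2.1.subst hle (by rw [hsub]; exact ih.2)⟩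
    case substTermEq Γ t₁ t₂ S Δ t' S' =>
      exact ⟨ih.1.1.subst hle (by rw [hsub]; exact ih.2.1),
        ih.1.2.1.subst hle (by rw [hsub]; exact ih.2.1),
        ih.1.2.1.subst hle (by rw [hsub]; exact ih.2.2)⟩

theorem nonempty_of_derives (T : GAT.{u}) {J} (h : Derives T.Λ J) : Nonempty (T.Ω ⊕ T.Con) := by
  induction h with
  | basic J hJ hb ih =>
    rcases J with ⟨Γ, T' | ⟨t, T'⟩ | ⟨T', T''⟩ | ⟨t, t', T'⟩⟩
    · rcases T.basic _ hJ with ⟨A, h⟩ | ⟨f, T', h⟩ | h | h <;> simp [Body.form] at h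
      exact ⟨.inl A⟩
    · rcases T.basic _ hJ with ⟨A, h⟩ | ⟨f, T', h⟩ | h | h <;> simp [Body.form] at h
      exact ⟨.inr f⟩
    · simp [Judgement.boundary] at ih
      exact nonempty_sum.2 ih
    · simp [Judgement.boundary] at ih
      exact nonempty_sum.2 ih
  | rule r Js J hr hd ih =>
    cases hr <;> exact ih _ (List.mem_cons_self)

/-- Substitution respects provable equality of contexts. -/
theorem ctxEq_subst {W : Type u} {Λ : Set (Judgement W)} {Φ Ψ : List (Expr W)} {s s' U U'}
    (hs : Derives Λ ⟨Φ, .termEq s s' U⟩) :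
    ∀ {Δ₁ Δ₂ : List (Expr W)}, CtxEq Λ (Δ₁ ++ U :: Φ) (Δ₂ ++ U' :: Ψ) →
      Δ₁.length = Δ₂.length →
      CtxDer Λ (Δ₁ ++ U :: Φ) →
      CtxEq Λ (substCtx Δ₁ Φ.length s ++ Φ) (substCtx Δ₂ Ψ.length s' ++ Ψ)
  | [], [], h, _, _ => by cases h; assumption
  | D₁ :: Δ₁, D₂ :: Δ₂, h, hl, hd => by
    cases h with
    | cons h hD =>
      have ih := ctxEq_subst hs h (by simpa using hl) hd.tail
      refine .cons ih ?_
      have hl' : Φ.length = Ψ.length := by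
        have := h.length_eq; simp at this hl; omega
      rw [← hl']
      have h1 := Derives.subst Δ₁ (hs.presup _ (List.mem_cons_self)) hD
      have h2 := substCtx_conv (.rule1 (.termSymm _ _ _ _) hs) Δ₁ hd.tail [] _
        (.rule2 (.substTypeEq Φ s s' U Δ₁ D₂) hs (hD.presup _ (by simp [Judgement.boundary])))
      exact .rule2 (.typeTrans _ _ _ _) h1 h2

theorem congr_subst {W : Type u} {Λ : Set (Judgement W)} {Φ Ψ : List (Expr W)} {s s' U U'}
    {Δ₁ Δ₂ : List (Expr W)} {b b' : Body W}
    (hs : Congr Λ ⟨Φ, .term s U⟩ ⟨Ψ, .term s' U'⟩)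
    (hb : Congr Λ ⟨Δ₁ ++ U :: Φ, b⟩ ⟨Δ₂ ++ U' :: Ψ, b'⟩) (hd : Derives Λ ⟨Δ₁ ++ U :: Φ, b⟩)
    (hl : Δ₁.length = Δ₂.length) :
    Congr Λ ⟨substCtx Δ₁ Φ.length s ++ Φ, b.subst Φ.length s⟩
      ⟨substCtx Δ₂ Ψ.length s' ++ Ψ, b'.subst Ψ.length s'⟩ := by
  have hl' : Φ.length = Ψ.length := by
    have := hs.1.length_eq; simpa using this
  match b, b', hb, hd with
  | .type A, .type A', hb, hd =>
    exact ctxEq_subst (Δ₁ := A :: Δ₁) (Δ₂ := A' :: Δ₂) hs.2 hb (by simpa using hl)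
      (hd.ctxDer.cons hd)
  | .term t A, .term t' A', hb, hd =>
    have hA := hd.presup _ (List.mem_cons_self)
    refine ⟨ctxEq_subst (Δ₁ := A :: Δ₁) (Δ₂ := A' :: Δ₂) hs.2 hb.1 (by simpa using hl)
      (hd.ctxDer.cons hA), ?_⟩
    have ht' : Derives Λ ⟨Δ₁ ++ U :: Φ, .term t' A⟩ := hb.2.presup _ (by simp [Judgement.boundary])
    have h1 := Derives.subst Δ₁ (hs.2.presup _ (List.mem_cons_self)) hb.2
    have h2 := substCtx_conv (.rule1 (.termSymm _ _ _ _) hs.2) Δ₁ hd.ctxDer [] _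
      (.rule2 (.substTermEq Φ s s' U Δ₁ t' A) hs.2 ht')
    have h3 : Derives Λ ⟨substCtx Δ₁ Φ.length s ++ Φ,
        .typeEq (A.subst Φ.length s) (A.subst Φ.length s')⟩ :=
      substCtx_conv (.rule1 (.termSymm _ _ _ _) hs.2) Δ₁ hd.ctxDer [] _
        (.rule2 (.substTypeEq Φ s s' U Δ₁ A) hs.2 hA)
    rw [← hl']
    exact .rule2 (.termTrans _ _ _ _ _) h1
      (.rule2 (.termEqConv _ _ _ _ _) (.rule1 (.typeSymm _ _ _) h3) h2)

end GAT

section FreeUniversal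
variable {X : Struct.{u}} {T : GAT.{u}}

/-- The equality judgements among the judgement bodies are reflexivities. -/
def Body.IsRefl {W : Type u} : Body W → Prop
  | .typeEq A B => A = B
  | .termEq s t _ => s = t
  | _ => True

/-- The only derivable equalities of the free theory are reflexivities. -/
theorem free_eq {J} (h : Derives (freeBasic X) J) : J.body.IsRefl := by
  induction h with
  | basic J hJ _ _ =>
    obtain ⟨n, A, rfl⟩ | ⟨n, a, rfl⟩ := hJ
    · trivial
    · trivial
  | rule r Js J hr hd ih =>
    cases hr <;>
      simp only [List.mem_cons, List.not_mem_nil, or_false, forall_eq_or_imp, forall_eq] at ih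
    case termRefl => rfl
    case termSymm => exact ih.symm
    case termTrans => exact ih.1.trans ih.2
    case typeRefl => rfl
    case typeSymm => exact ih.symm
    case typeTrans => exact ih.1.trans ih.2
    case termConv => trivial
    case termEqConv => exact ih.2
    case ctxConv => exact ih.2
    case subst Γ t S Δ b =>
      rcases b with _ | _ | ⟨A, B⟩ | ⟨s, t, A⟩
      · trivial
      · trivial
      · exact congrArg (fun e => Expr.subst e Γ.length t) ih.2
      · rename_i t'
        exact congrArg (fun e => Expr.subst e Γ.length t') ih.2
    case substTypeEq Γ t₁ t₂ S Δ S' =>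
      obtain rfl : t₁ = t₂ := ih.1
      rfl
    case substTermEq Γ t₁ t₂ S Δ t' S' =>
      obtain rfl : t₁ = t₂ := ih.1
      rfl

theorem length_eq_of_degree {W W' : Type u} {J : Judgement W} {K : Judgement W'}
    (h : J.degree = K.degree) : J.ctx.length = K.ctx.length := by
  simpa [Judgement.degree] using h

/-- Interpretations of the free theory that agree on the basic judgements are equal. -/
theorem free_unique (φ ψ : GAT.Interp (freeGAT X) T)
    (hty : ∀ {n : ℕ} (A : X.Ty n), Congr T.Λ (φ.toFun (genTyJudg X A).1).1
      (ψ.toFun (genTyJudg X A).1).1)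
    (htm : ∀ {n : ℕ} (a : X.Tm n), Congr T.Λ (φ.toFun (genTmJudg X a).1).1
      (ψ.toFun (genTmJudg X a).1).1) : φ ≈ ψ := by
  suffices H : ∀ J (h : Derives (freeGAT X).Λ J), J.IsTypeOrTerm →
      Congr T.Λ (φ.toFun ⟨J, h⟩).1 (ψ.toFun ⟨J, h⟩).1 from fun J hJ => H J.1 J.2 hJ
  intro J h
  induction h with
  | basic J hJ _ _ =>
    intro _
    obtain ⟨n, A, rfl⟩ | ⟨n, a, rfl⟩ := hJ
    · exact hty A
    · exact htm a
  | rule r Js J hr hd ih =>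
    intro hJ
    cases hr
    case termConv Γ T₁ T₂ t =>
      have hd1 := hd _ List.mem_cons_self
      have hd2 := hd _ (List.mem_cons_of_mem _ List.mem_cons_self)
      have ih1 := ih _ List.mem_cons_self
      have ih2 := ih _ (List.mem_cons_of_mem _ List.mem_cons_self)
      obtain rfl : T₁ = T₂ := free_eq hd1
      exact ih2 hJ
    case ctxConv Γ T₁ T₂ Δ b =>
      have hd1 := hd _ List.mem_cons_self
      have hd2 := hd _ (List.mem_cons_of_mem _ List.mem_cons_self)
      have ih1 := ih _ List.mem_cons_self
      have ih2 := ih _ (List.mem_cons_of_mem _ List.mem_cons_self)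
      obtain rfl : T₁ = T₂ := free_eq hd1
      exact ih2 hJ
    case subst Γ t S Δ b =>
      have hd1 := hd _ List.mem_cons_self
      have hd2 := hd _ (List.mem_cons_of_mem _ List.mem_cons_self)
      have ih1 := ih _ List.mem_cons_self
      have ih2 := ih _ (List.mem_cons_of_mem _ List.mem_cons_self)
      have hb : (⟨Δ ++ S :: Γ, b⟩ : Judgement _).IsTypeOrTerm := by
        rcases b <;> first | exact .inl rfl | exact .inr rfl | simp [Judgement.IsTypeOrTerm, Body.form, Body.subst] at hJ
      have h1 := ih1 (.inr rfl)
      have h2 := ih2 hb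
      have hc := Derives.subst Δ hd1 hd2
      have e1 := φ.map_rule .subst [⟨_, hd1⟩, ⟨_, hd2⟩] ⟨_, hc⟩ (.subst Γ t S Δ b)
      have e2 := ψ.map_rule .subst [⟨_, hd1⟩, ⟨_, hd2⟩] ⟨_, hc⟩ (.subst Γ t S Δ b)
      have hd3 := (φ.toFun ⟨_, hd2⟩).2
      have l1 := length_eq_of_degree ((φ.map_degree ⟨_, hd1⟩).trans (ψ.map_degree ⟨_, hd1⟩).symm)
      have l2 := length_eq_of_degree ((φ.map_degree ⟨_, hd2⟩).trans (ψ.map_degree ⟨_, hd2⟩).symm)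
      simp only [List.map] at e1 e2
      revert h1 h2 e1 e2 hd3 l1 l2
      change _ → _ → _ → _ → _ → _ → _ → Congr T.Λ (φ.toFun ⟨_, hc⟩).1 (ψ.toFun ⟨_, hc⟩).1
      generalize (φ.toFun ⟨_, hd1⟩).1 = K1
      generalize (φ.toFun ⟨_, hd2⟩).1 = K2
      generalize (φ.toFun ⟨_, hc⟩).1 = K3
      generalize (ψ.toFun ⟨_, hd1⟩).1 = L1
      generalize (ψ.toFun ⟨_, hd2⟩).1 = L2
      generalize (ψ.toFun ⟨_, hc⟩).1 = L3
      intro h1 h2 e1 e2 hd3 l1 l2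
      cases e1
      cases e2
      refine GAT.congr_subst h1 h2 hd3 ?_
      simp at l1 l2
      omega
    all_goals simp [Judgement.IsTypeOrTerm, Body.form] at hJ

/-- A type judgement represents a type-element. -/
def IsRep (T : GAT.{u}) {n : ℕ} (B : T.toStruct.Ty n)
    (p : List (Expr (T.Ω ⊕ T.Con)) × Expr (T.Ω ⊕ T.Con)) : Prop :=
  ∃ (h : Derives T.Λ ⟨p.1, .type p.2⟩) (hl : p.1.length = n),
    B = T.tyMk ⟨⟨⟨p.1, .type p.2⟩, h⟩, rfl, congrArg (· + 1) hl⟩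

theorem exists_tyMk {n : ℕ} (B : T.toStruct.Ty n) :
    ∃ Γ D, ∃ (h : Derives T.Λ ⟨Γ, .type D⟩) (hl : Γ.length + 1 = n + 1),
      B = T.tyMk ⟨⟨⟨Γ, .type D⟩, h⟩, rfl, hl⟩ := by
  obtain ⟨J, rfl⟩ := T.tyMk_surj B
  match J with
  | ⟨⟨⟨Γ, .type D⟩, hd⟩, _, hl⟩ => exact ⟨Γ, D, hd, hl, rfl⟩

theorem exists_tmMk {n : ℕ} (B : T.toStruct.Tm n) :
    ∃ Γ t D, ∃ (h : Derives T.Λ ⟨Γ, .term t D⟩) (hl : Γ.length + 1 = n + 1),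
      B = T.tmMk ⟨⟨⟨Γ, .term t D⟩, h⟩, rfl, hl⟩ := by
  obtain ⟨J, rfl⟩ := T.tmMk_surj B
  match J with
  | ⟨⟨⟨Γ, .term t D⟩, hd⟩, _, hl⟩ => exact ⟨Γ, t, D, hd, hl, rfl⟩

theorem exists_rep_zero (B : T.toStruct.Ty 0) : ∃ D, IsRep T B ([], D) := by
  obtain ⟨Γ, D, hd, hl, rfl⟩ := exists_tyMk B
  have : Γ = [] := by simpa using hl
  subst this
  exact ⟨D, hd, rfl, rfl⟩

theorem exists_rep_succ {n : ℕ} (B : T.toStruct.Ty (n + 1)) {p} (hp : IsRep T (T.toStruct.bdTy B) p) :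
    ∃ D, IsRep T B (p.2 :: p.1, D) := by
  obtain ⟨Γ, D, hd, hl, rfl⟩ := exists_tyMk B
  rcases Γ with _ | ⟨S, Γ⟩
  · simp at hl
  obtain ⟨hp, hpl, he⟩ := hp
  have he' : CtxEq T.Λ (S :: Γ) (p.2 :: p.1) := GAT.tyMk_eq.1 he
  refine ⟨D, he'.derives [] _ hd, by simp [hpl], ?_⟩
  exact GAT.tyMk_eq.2 (CtxEq.cons he' (.rule1 (.typeRefl _ _) hd))

theorem exists_rep_term {n : ℕ} (a : T.toStruct.Tm n) {p} (hp : IsRep T (T.toStruct.bdTm a) p) :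
    ∃ t, ∃ (h : Derives T.Λ ⟨p.1, .term t p.2⟩) (hl : p.1.length = n),
      a = T.tmMk ⟨⟨⟨p.1, .term t p.2⟩, h⟩, rfl, congrArg (· + 1) hl⟩ := by
  obtain ⟨Γ, t, D, hd, hl, rfl⟩ := exists_tmMk a
  obtain ⟨hp, hpl, he⟩ := hp
  have he' : CtxEq T.Λ (D :: Γ) (p.2 :: p.1) := GAT.tyMk_eq.1 he
  cases he' with
  | cons h1 h2 =>
    refine ⟨t, h1.derives [] _ (.rule2 (.termConv _ _ _ _) h2 hd), hpl, ?_⟩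
    exact GAT.tmMk_eq.2 ⟨.cons h1 h2, .rule1 (.termRefl _ _ _) hd⟩

/-- Representatives of the images of the type-elements, with compatible contexts. -/
noncomputable def tyRep (f : X ⟶ T.toStruct) :
    ∀ (n : ℕ) (A : X.Ty n), {p // IsRep T (Struct.mapTy f A) p}
  | 0, A => ⟨([], Classical.choose (exists_rep_zero (Struct.mapTy f A))),
      Classical.choose_spec (exists_rep_zero (Struct.mapTy f A))⟩
  | n + 1, A =>
    have h := exists_rep_succ (Struct.mapTy f A) (p := (tyRep f n (X.bdTy A)).1)
      (by rw [Struct.bdTy_mapTy]; exact (tyRep f n (X.bdTy A)).2)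
    ⟨((tyRep f n (X.bdTy A)).1.2 :: (tyRep f n (X.bdTy A)).1.1, Classical.choose h),
      Classical.choose_spec h⟩

theorem tmRep_exists (f : X ⟶ T.toStruct) {n : ℕ} (a : X.Tm n) :
    ∃ t, ∃ (h : Derives T.Λ ⟨(tyRep f n (X.bdTm a)).1.1, .term t (tyRep f n (X.bdTm a)).1.2⟩)
      (hl : (tyRep f n (X.bdTm a)).1.1.length = n),
      Struct.mapTm f a = T.tmMk ⟨⟨_, h⟩, rfl, congrArg (· + 1) hl⟩ :=
  exists_rep_term (Struct.mapTm f a) (p := (tyRep f n (X.bdTm a)).1)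
      (by rw [Struct.bdTm_mapTm]; exact (tyRep f n (X.bdTm a)).2)

/-- Representatives of the images of the term-elements. -/
noncomputable def tmRep (f : X ⟶ T.toStruct) {n : ℕ} (a : X.Tm n) : Expr (T.Ω ⊕ T.Con) :=
  Classical.choose (tmRep_exists f a)

/-- The representative of a constant. -/
noncomputable def conRep (f : X ⟶ T.toStruct) : Alphabet X → Expr (T.Ω ⊕ T.Con)
  | .inl A => (tyRep f A.1 A.2).1.2
  | .inr a => tmRep f a.2

theorem tyRep_scoped (f : X ⟶ T.toStruct) {n : ℕ} (A : X.Ty n) :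
    (tyRep f n A).1.2.Scoped n := by
  obtain ⟨h, hl, _⟩ := (tyRep f n A).2
  have := T.derives_scoped h
  rwa [hl] at this

theorem tmRep_scoped (f : X ⟶ T.toStruct) {n : ℕ} (a : X.Tm n) : (tmRep f a).Scoped n := by
  obtain ⟨h, hl, _⟩ := Classical.choose_spec (tmRep_exists f a)
  exact (T.derives_scoped h).1.mono hl.le

/-- The translation of expressions given by representatives of the constants; `c` is
a closed expression that stands for missing arguments. -/
noncomputable def Expr.trans (f : X ⟶ T.toStruct) (c : T.Ω ⊕ T.Con) :
    Expr (Alphabet X) → Expr (T.Ω ⊕ T.Con)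
  | .var i => .var i
  | .app w m args => (conRep f w).bind fun i =>
      if h : i < m then (args ⟨i, h⟩).trans f c else .app c 0 Fin.elim0

theorem Expr.trans_subst (f : X ⟶ T.toStruct) (c) (k : ℕ) (t : Expr (Alphabet X)) :
    ∀ e : Expr (Alphabet X), (e.subst k t).trans f c = (e.trans f c).subst k (t.trans f c)
  | .var i => by
    simp only [Expr.subst, Expr.trans]
    split_ifs <;> rfl
  | .app w m args => by
    simp only [Expr.subst, Expr.trans, Expr.subst_bind]
    congr 1
    funext i
    split_ifs with h
    · exact Expr.trans_subst f c k t _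
    · simp only [Expr.subst]
      congr 1
      funext i
      exact i.elim0

theorem Expr.trans_generic (f : X ⟶ T.toStruct) (c) {n : ℕ} (w : Alphabet X)
    (h : (conRep f w).Scoped n) : (Expr.generic w n).trans f c = conRep f w := by
  simp only [Expr.generic, Expr.trans]
  rw [Expr.bind_congr (τ := .var) _ h, Expr.bind_var]
  intro i hi
  simp [hi]

/-- Translation of judgement bodies. -/
noncomputable def Body.trans (f : X ⟶ T.toStruct) (c : T.Ω ⊕ T.Con) :
    Body (Alphabet X) → Body (T.Ω ⊕ T.Con)
  | .type A => .type (A.trans f c)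
  | .term t A => .term (t.trans f c) (A.trans f c)
  | .typeEq A B => .typeEq (A.trans f c) (B.trans f c)
  | .termEq s t A => .termEq (s.trans f c) (t.trans f c) (A.trans f c)

/-- Translation of judgements. -/
noncomputable def Judgement.trans (f : X ⟶ T.toStruct) (c : T.Ω ⊕ T.Con) (J : Judgement (Alphabet X)) :
    Judgement (T.Ω ⊕ T.Con) :=
  ⟨J.ctx.map (Expr.trans f c), J.body.trans f c⟩

theorem Body.trans_subst (f : X ⟶ T.toStruct) (c) (k : ℕ) (t : Expr (Alphabet X)) (b) :
    (Body.subst b k t).trans f c = (b.trans f c).subst k (t.trans f c) := by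
  cases b <;> simp [Body.subst, Body.trans, Expr.trans_subst]

theorem substCtx_trans (f : X ⟶ T.toStruct) (c) (k : ℕ) (t : Expr (Alphabet X)) (Δ) :
    (substCtx Δ k t).map (Expr.trans f c) =
      substCtx (Δ.map (Expr.trans f c)) k (t.trans f c) := by
  simp [substCtx, Expr.trans_subst, Function.comp_def]

theorem boundary_trans (f : X ⟶ T.toStruct) (c) (J : Judgement (Alphabet X)) :
    (J.trans f c).boundary = J.boundary.map (Judgement.trans f c) := by
  rcases J with ⟨_ | ⟨S, Γ⟩, _ | _ | _ | _⟩ <;> rfl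

theorem rule_trans (f : X ⟶ T.toStruct) (c) {r Js} {J : Judgement (Alphabet X)}
    (h : Rule r Js J) : Rule r (Js.map (Judgement.trans f c)) (J.trans f c) := by
  cases h
  case termRefl => constructor
  case termSymm => constructor
  case termTrans => constructor
  case typeRefl => constructor
  case typeSymm => constructor
  case typeTrans => constructor
  case termConv => constructor
  case termEqConv => constructor
  case ctxConv Γ A B Δ b =>
    simp only [List.map, Judgement.trans, List.map_append]
    constructor
  case subst Γ t S Δ b =>
    have := Rule.subst (Γ.map (Expr.trans f c)) (t.trans f c) (S.trans f c)
      (Δ.map (Expr.trans f c)) (b.trans f c)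
    rw [List.length_map] at this
    simp only [List.map, Judgement.trans, Body.trans_subst, List.map_append, substCtx_trans]
    exact this
  case substTypeEq Γ t₁ t₂ S Δ S' =>
    have := Rule.substTypeEq (Γ.map (Expr.trans f c)) (t₁.trans f c) (t₂.trans f c) (S.trans f c)
      (Δ.map (Expr.trans f c)) (S'.trans f c)
    rw [List.length_map] at this
    simpa [Judgement.trans, Body.trans, substCtx_trans, Expr.trans_subst] using this
  case substTermEq Γ t₁ t₂ S Δ t' S' =>
    have := Rule.substTermEq (Γ.map (Expr.trans f c)) (t₁.trans f c) (t₂.trans f c) (S.trans f c)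
      (Δ.map (Expr.trans f c)) (t'.trans f c) (S'.trans f c)
    rw [List.length_map] at this
    simpa [Judgement.trans, Body.trans, substCtx_trans, Expr.trans_subst] using this

theorem genCtx_trans (f : X ⟶ T.toStruct) (c) : ∀ {n : ℕ} (A : X.Ty n),
    (genCtx X A).map (Expr.trans f c) = (tyRep f n A).1.1
  | 0, A => rfl
  | n + 1, A => by
    simp only [genCtx, List.map_cons, genCtx_trans f c (X.bdTy A)]
    rw [genTy, Expr.trans_generic f c _ (tyRep_scoped f _)]
    rfl

theorem genTyJ_trans (f : X ⟶ T.toStruct) (c) {n : ℕ} (A : X.Ty n) :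
    (genTyJ X A).trans f c = ⟨(tyRep f n A).1.1, .type (tyRep f n A).1.2⟩ := by
  simp only [genTyJ, Judgement.trans, genCtx_trans, Body.trans]
  rw [genTy, Expr.trans_generic f c _ (tyRep_scoped f _)]
  rfl

theorem genTmJ_trans (f : X ⟶ T.toStruct) (c) {n : ℕ} (a : X.Tm n) :
    (genTmJ X a).trans f c =
      ⟨(tyRep f n (X.bdTm a)).1.1, .term (tmRep f a) (tyRep f n (X.bdTm a)).1.2⟩ := by
  simp only [genTmJ, Judgement.trans, genCtx_trans, Body.trans]
  rw [genTy, Expr.trans_generic f c _ (tyRep_scoped f _), genTm,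
    Expr.trans_generic f c _ (tmRep_scoped f _)]
  rfl

theorem derives_trans (f : X ⟶ T.toStruct) (c) {J} (h : Derives (freeBasic X) J) :
    Derives T.Λ (J.trans f c) := by
  induction h with
  | basic J hJ _ _ =>
    obtain ⟨n, A, rfl⟩ | ⟨n, a, rfl⟩ := hJ
    · rw [genTyJ_trans]
      exact (tyRep f n A).2.1
    · rw [genTmJ_trans]
      exact (Classical.choose_spec (tmRep_exists f a)).1
  | rule r Js J hr hd ih =>
    refine .rule r _ _ (rule_trans f c hr) fun K hK => ?_
    obtain ⟨K, hK', rfl⟩ := List.mem_map.1 hK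
    exact ih K hK'

/-- The interpretation of the free theory given by representatives. -/
noncomputable def transInterp (f : X ⟶ T.toStruct) (c : T.Ω ⊕ T.Con) :
    GAT.Interp (freeGAT X) T where
  toFun J := ⟨J.1.trans f c, derives_trans f c J.2⟩
  map_form J := by
    rcases J with ⟨⟨Γ, _ | _ | _ | _⟩, h⟩ <;> rfl
  map_boundary J := by
    apply List.map_injective_iff.2 Subtype.val_injective
    rw [GAT.boundary, GAT.boundary, List.map_map, List.map_pmap, List.map_pmap]
    have h1 : ∀ {p : Judgement (Alphabet X) → Prop} (l : List (Judgement (Alphabet X)))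
        (h : ∀ K ∈ l, p K), l.pmap (fun K _ => K.trans f c) h = l.map (Judgement.trans f c) :=
      fun l h => List.pmap_eq_map h
    have h0 : ∀ (l : List (Judgement (T.Ω ⊕ T.Con))) (h : ∀ K ∈ l, Derives T.Λ K),
        l.pmap (fun K h => (⟨K, h⟩ : T.Derived).1) h = l :=
      fun l h => (List.pmap_eq_map h).trans (List.map_id l)
    exact (h0 _ _).trans ((boundary_trans f c J.1).trans (h1 _ _).symm)
  map_rule r Js J h := by
    have := rule_trans f c h
    have e : (Js.map Subtype.val).map (Judgement.trans f c) =
        Js.map fun J => J.1.trans f c := List.map_map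
    rw [e] at this
    rw [List.map_map]
    exact this

theorem freeUnit_transInterp (f : X ⟶ T.toStruct) (c) :
    freeUnit X ≫ (transInterp f c).toStructHom = f := by
  apply Struct.hom_ext
  · intro n A
    have h1 : Struct.mapTy (freeUnit X ≫ (transInterp f c).toStructHom) A =
      T.tyMk ((transInterp f c).mapJudg (genTyJudg X A)) := rfl
    obtain ⟨h, hl, e⟩ := (tyRep f n A).2
    rw [h1, e]
    congr 1
    exact Subtype.ext (Subtype.ext (genTyJ_trans f c A))
  · intro n a
    have h1 : Struct.mapTm (freeUnit X ≫ (transInterp f c).toStructHom) a =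
      T.tmMk ((transInterp f c).mapJudg (genTmJudg X a)) := rfl
    obtain ⟨h, hl, e⟩ := Classical.choose_spec (tmRep_exists f a)
    rw [h1, e]
    congr 1
    exact Subtype.ext (Subtype.ext (genTmJ_trans f c a))

/-- The interpretation of a theory without derivable judgements. -/
def emptyInterp (h : ∀ J, ¬ Derives (freeGAT X).Λ J) : GAT.Interp (freeGAT X) T where
  toFun J := (h J.1 J.2).elim
  map_form J := (h J.1 J.2).elim
  map_boundary J := (h J.1 J.2).elim
  map_rule _ _ J := (h J.1 J.2).elim

variable (X T)

/-- The free theory is free: maps `X ⟶ V T` correspond to morphisms from the free theory on `X`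
to `T`. -/
theorem freeUnit_bijective :
    Function.Bijective fun g : freeGAT X ⟶ T => freeUnit X ≫ GAT.forgetful.map g := by
  constructor
  · intro g g' h
    induction g using Quotient.ind with | _ φ
    induction g' using Quotient.ind with | _ ψ
    refine Quotient.sound (free_unique φ ψ (fun A => ?_) (fun a => ?_))
    · exact GAT.tyMk_eq.1 (congrArg (fun k => Struct.mapTy (Y := T.toStruct) k A) h)
    · exact GAT.tmMk_eq.1 (congrArg (fun k => Struct.mapTm (Y := T.toStruct) k a) h)
  · intro f
    by_cases hc : Nonempty (T.Ω ⊕ T.Con)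
    · exact ⟨Quotient.mk _ (transInterp f hc.some), freeUnit_transInterp f _⟩
    · have hTy : ∀ n, X.Ty n → False := fun n A => hc (by
        obtain ⟨J, _⟩ := T.tyMk_surj (Struct.mapTy f A)
        exact T.nonempty_of_derives J.1.2)
      have hTm : ∀ n, X.Tm n → False := fun n a => hTy n (X.bdTm a)
      refine ⟨Quotient.mk _ (emptyInterp fun J hJ => ?_), ?_⟩
      · obtain ⟨⟨n, A⟩ | ⟨n, a⟩⟩ := (freeGAT X).nonempty_of_derives hJ
        · exact hTy n A
        · exact hTm n a
      · apply Struct.hom_ext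
        · exact fun n A => (hTy n A).elim
        · exact fun n a => (hTm n a).elim

end FreeUniversal

/-! ## The substitution monad -/

/-- The bijection between morphisms from the free theory and maps of type-and-term structures. -/
noncomputable def freeHomEquiv (X : Struct.{u}) (T : GAT.{u}) :
    (freeGAT X ⟶ T) ≃ (X ⟶ GAT.forgetful.obj T) :=
  Equiv.ofBijective (fun g => freeUnit X ≫ GAT.forgetful.map g) (freeUnit_bijective X T)

theorem freeHomEquiv_naturality (X : Struct.{u}) (T U : GAT.{u}) (g : T ⟶ U)
    (h : freeGAT X ⟶ T) :
    freeHomEquiv X U (h ≫ g) = freeHomEquiv X T h ≫ GAT.forgetful.map g := by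
  simp [freeHomEquiv]

/-- The free functor. -/
noncomputable def free : Struct.{u} ⥤ GAT.{u} :=
  Adjunction.leftAdjointOfEquiv freeHomEquiv freeHomEquiv_naturality

/-- The free-forgetful adjunction. -/
noncomputable def freeForgetful : free.{u} ⊣ GAT.forgetful.{u} :=
  Adjunction.adjunctionOfEquivLeft freeHomEquiv freeHomEquiv_naturality

/-- The substitution monad, induced by the free-forgetful adjunction. -/
noncomputable def substMonad : Monad Struct.{u} := freeForgetful.toMonad

theorem substMonad_obj (X : Struct.{u}) : substMonad.obj X = (freeGAT X).toStruct := rfl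

theorem substMonad_η (X : Struct.{u}) : substMonad.η.app X = freeUnit X := by
  change freeUnit X ≫ GAT.forgetful.map (𝟙 _) = _
  rw [CategoryTheory.Functor.map_id]
  exact Category.comp_id _

/-! ## Inc-lists -/

/-- Inc-lists of length `n + 1`.  Since degrees are indexed from `0` and the value `α(0) = 0` is
omitted, such a list is a strictly increasing function from `{0, …, n}` to `ℕ`. -/
abbrev Inc (n : ℕ) : Type := Fin (n + 1) ↪o ℕ

namespace Inc

/-- The last value of an inc-list. -/
def last {n : ℕ} (α : Inc n) : ℕ := α (Fin.last n)

theorem le_last {n : ℕ} (α : Inc n) (i : Fin (n + 1)) : α i ≤ α.last :=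
  α.monotone (Fin.le_last i)

/-- The restriction of an inc-list to its first `m + 1` values. -/
def res {n : ℕ} (α : Inc n) (m : ℕ) (h : m ≤ n) : Inc m :=
  (Fin.castLEOrderEmb (Nat.succ_le_succ h)).trans α

theorem last_res_le {n : ℕ} (α : Inc n) (m : ℕ) (h : m ≤ n) : (α.res m h).last ≤ α.last :=
  α.le_last _

/-- The type-and-term structure `[α]` that encodes a type judgement of shape `α`: it has exactly
one type-element in each degree up to the last value of `α`, and exactly one term-element over each
of these whose degree is not a value of `α`. -/
def shape {n : ℕ} (α : Inc n) : Struct.{u} :=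
  Struct.mk (fun j => ULift.{u} (PLift (j ≤ α.last)))
    (fun j => ULift.{u} (PLift (j ≤ α.last ∧ j ∉ Set.range α)))
    (fun _ x => ⟨⟨Nat.le_of_succ_le x.down.down⟩⟩) (fun _ x => ⟨⟨x.down.down.1⟩⟩)

/-- The type-element of degree `j + 1` of `[α]`. -/
def shapeTy {n : ℕ} (α : Inc n) (j : ℕ) (hj : j ≤ α.last) : (shape.{u} α).Ty j := ULift.up ⟨hj⟩

/-- The term-element of degree `j + 1` of `[α]`. -/
def shapeTm {n : ℕ} (α : Inc n) (j : ℕ) (hj : j ≤ α.last) (hα : j ∉ Set.range α) :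
    (shape.{u} α).Tm j := ULift.up ⟨hj, hα⟩

theorem mem_range_res {n : ℕ} (α : Inc n) (m : ℕ) (h : m ≤ n) {j : ℕ}
    (hj : j ≤ (α.res m h).last) : j ∈ Set.range (α.res m h) ↔ j ∈ Set.range α := by
  constructor
  · rintro ⟨p, rfl⟩; exact ⟨_, rfl⟩
  · rintro ⟨p, rfl⟩
    have h1 : p ≤ Fin.castLE (Nat.succ_le_succ h) (Fin.last m) := α.le_iff_le.1 hj
    exact ⟨⟨p.1, Nat.lt_succ_of_le h1⟩, rfl⟩

/-- The inclusion of the shape of a restriction. -/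
def shapeIncl {n : ℕ} (α : Inc n) (m : ℕ) (h : m ≤ n) :
    shape.{u} (α.res m h) ⟶ shape.{u} α :=
  Struct.homMk (X := shape.{u} (α.res m h)) (Y := shape.{u} α)
    (fun j x => α.shapeTy j (x.down.down.trans (α.last_res_le m h)))
    (fun j x => α.shapeTm j (x.down.down.1.trans (α.last_res_le m h))
      fun hj => x.down.down.2 ((α.mem_range_res m h x.down.down.1).2 hj))
    (fun _ _ => rfl) (fun _ _ => rfl)

end Inc

section Elements
variable {X : Struct.{u}}

/-- The type-element `h(j)`, for `h : [α] ⟶ X`. -/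
def lblTy {n : ℕ} {α : Inc n} (h : α.shape ⟶ X) (j : ℕ) (hj : j ≤ α.last) : X.Ty j :=
  Struct.mapTy h (α.shapeTy j hj)

/-- The term-element `h(j_t)`, for `h : [α] ⟶ X`. -/
def lblTm {n : ℕ} {α : Inc n} (h : α.shape ⟶ X) (j : ℕ) (hj : j ≤ α.last)
    (hα : j ∉ Set.range α) : X.Tm j :=
  Struct.mapTm h (α.shapeTm j hj hα)

theorem bdTy_lblTy {n : ℕ} {α : Inc n} (h : α.shape ⟶ X) (j : ℕ) (hj : j + 1 ≤ α.last) :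
    X.bdTy (lblTy h (j + 1) hj) = lblTy h j (Nat.le_of_succ_le hj) :=
  Struct.bdTy_mapTy h _

theorem bdTm_lblTm {n : ℕ} {α : Inc n} (h : α.shape ⟶ X) (j : ℕ) (hj : j ≤ α.last)
    (hα : j ∉ Set.range α) : X.bdTm (lblTm h j hj hα) = lblTy h j hj :=
  Struct.bdTm_mapTm h _

/-- The restriction of `h : [α] ⟶ X` to the shape of a restriction of `α`. -/
def lblRes {n : ℕ} {α : Inc n} (h : α.shape ⟶ X) (m : ℕ) (hm : m ≤ n) :
    (α.res m hm).shape ⟶ X :=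
  α.shapeIncl m hm ≫ h

open Classical in
/-- The expression that replaces the `j`-th variable in the judgement of shape `α` and
labelling `h`: it is `x_p` if `j = α(p)`, and it is the term `h(j_t)` applied to the expressions
for the smaller variables if `j` is not a value of `α`. -/
noncomputable def argExpr {n : ℕ} (α : Inc n) (h : α.shape ⟶ X) (j : ℕ) (hj : j ≤ α.last) :
    Expr (Alphabet X) :=
  if hα : j ∈ Set.range α then .var (Classical.choose hα).1
  else .app (.inr ⟨j, lblTm h j hj hα⟩) j fun i => argExpr α h i.1 (i.2.le.trans hj)
termination_by j
decreasing_by exact i.2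

/-- The last type of the judgement of shape `α` and labelling `h`. -/
noncomputable def typeExpr {n : ℕ} (α : Inc n) (h : α.shape ⟶ X) : Expr (Alphabet X) :=
  .app (.inl ⟨α.last, lblTy h α.last le_rfl⟩) α.last fun i => argExpr α h i.1 i.2.le

/-- The term given by a term-element over the last type-element of a labelling `h`. -/
noncomputable def termExpr {n : ℕ} (α : Inc n) (h : α.shape ⟶ X)
    (a : X.TmOver (lblTy h α.last le_rfl)) : Expr (Alphabet X) :=
  .app (.inr ⟨α.last, a.1⟩) α.last fun i => argExpr α h i.1 i.2.le

/-- The context of the judgement of shape `α` and labelling `h`. -/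
noncomputable def ctxOf : ∀ {n : ℕ} (α : Inc n) (_ : α.shape ⟶ X), List (Expr (Alphabet X))
  | 0, _, _ => []
  | n + 1, α, h => typeExpr (α.res n n.le_succ) (lblRes h n n.le_succ) ::
      ctxOf (α.res n n.le_succ) (lblRes h n n.le_succ)

theorem length_ctxOf : ∀ {n : ℕ} (α : Inc n) (h : α.shape ⟶ X), (ctxOf α h).length = n
  | 0, _, _ => rfl
  | _ + 1, _, _ => by simp [ctxOf, length_ctxOf]

/-! Derivability of the judgements of given shape and labelling.  In the following, `P` says which
variables are kept, and `c` and `d` are the type-constants and the term-constants. -/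

section Chain
variable {W : Type u} (c d : ℕ → W) (P Q : ℕ → Bool)

/-- The number of kept variables before the `j`-th one. -/
def cnt : ℕ → ℕ
  | 0 => 0
  | j + 1 => if P j then cnt j + 1 else cnt j

/-- The expression replacing the `j`-th variable. -/
def chainArg (j : ℕ) : Expr W :=
  if P j then .var (cnt P j) else .app (d j) j fun i => chainArg i.1
termination_by j
decreasing_by exact i.2

/-- The `j`-th type. -/
def chainTy (j : ℕ) : Expr W := .app (c j) j fun i => chainArg d P i.1

/-- The context before the `j`-th type. -/
def chainCtx : ℕ → List (Expr W)
  | 0 => []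
  | j + 1 => if P j then chainTy c d P j :: chainCtx j else chainCtx j

variable {P Q}

theorem cnt_congr {N : ℕ} (h : ∀ i < N, P i = Q i) : cnt P N = cnt Q N := by
  induction N with
  | zero => rfl
  | succ N ih => simp only [cnt, h N (by omega), ih fun i hi => h i (by omega)]

theorem chainArg_congr {N : ℕ} (h : ∀ i < N, P i = Q i) : ∀ j < N, chainArg d P j = chainArg d Q j := by
  intro j
  induction j using Nat.strong_induction_on with
  | _ j ih =>
    intro hj
    rw [chainArg, chainArg, h j hj, cnt_congr fun i hi => h i (by omega)]
    congr 2
    funext i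
    exact ih i.1 i.2 (by omega)

theorem chainTy_congr {N : ℕ} (h : ∀ i < N, P i = Q i) : chainTy c d P N = chainTy c d Q N := by
  simp only [chainTy]
  congr 1
  funext i
  exact chainArg_congr d h i.1 i.2

theorem chainCtx_congr {N : ℕ} (h : ∀ i < N, P i = Q i) : chainCtx c d P N = chainCtx c d Q N := by
  induction N with
  | zero => rfl
  | succ N ih =>
    simp only [chainCtx, h N (by omega), ih fun i hi => h i (by omega),
      chainTy_congr c d fun i (hi : i < N) => h i (by omega)]

theorem length_chainCtx (N : ℕ) : (chainCtx c d P N).length = cnt P N := by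
  induction N with
  | zero => rfl
  | succ N ih => simp only [chainCtx, cnt]; split_ifs <;> simp [ih]

theorem cnt_mono {i j : ℕ} (h : i ≤ j) : cnt P i ≤ cnt P j := by
  induction h with
  | refl => rfl
  | step _ ih => simp only [cnt]; split_ifs <;> omega

theorem cnt_lt {i j : ℕ} (h : i < j) (hP : P i) : cnt P i < cnt P j := by
  have : cnt P (i + 1) ≤ cnt P j := cnt_mono h
  simp only [cnt, hP, if_true] at this
  omega

variable (P) in
/-- Keep in addition all variables from the `m`-th one on. -/
def keepFrom (m : ℕ) (i : ℕ) : Bool := P i || decide (m ≤ i)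

theorem keepFrom_eq {m i : ℕ} (h : i ≠ m) : keepFrom P (m + 1) i = keepFrom P m i := by
  simp only [keepFrom]
  congr 2
  simp only [eq_iff_iff]
  omega

theorem cnt_keepFrom {m : ℕ} (hm : P m = false) {j : ℕ} (h : m < j) :
    cnt (keepFrom P m) j = cnt (keepFrom P (m + 1)) j + 1 := by
  induction h with
  | refl =>
    simp only [cnt]
    rw [cnt_congr (P := keepFrom P (m + 1)) (Q := keepFrom P m) fun i hi => keepFrom_eq (by omega)]
    simp [keepFrom, hm]
  | @step j h ih =>
    have h' : m < j := h
    simp only [cnt]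
    rw [keepFrom_eq (by omega : j ≠ m), ih]
    split_ifs <;> rfl

theorem chainArg_subst {m : ℕ} (hm : P m = false) (j : ℕ) :
    (chainArg d (keepFrom P m) j).subst (cnt (keepFrom P m) m)
      (.app (d m) m fun i => chainArg d (keepFrom P m) i.1) =
    chainArg d (keepFrom P (m + 1)) j := by
  induction j using Nat.strong_induction_on with
  | _ j ih =>
    rw [chainArg, chainArg]
    rcases lt_trichotomy j m with h | rfl | h
    · rw [keepFrom_eq h.ne]
      by_cases hj : keepFrom P m j = true
      · rw [if_pos hj, if_pos hj]
        simp only [Expr.subst, if_pos (cnt_lt h hj)]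
        rw [cnt_congr fun i hi => keepFrom_eq (by omega)]
      · rw [if_neg hj, if_neg hj]
        simp only [Expr.subst]
        congr 1
        funext i
        exact ih i.1 i.2
    · rw [if_pos (by simp [keepFrom]), if_neg (by simp [keepFrom, hm])]
      simp only [Expr.subst, lt_irrefl, if_false, if_true]
      congr 1
      funext i
      exact chainArg_congr d (fun i hi => (keepFrom_eq (by omega)).symm) i.1 i.2
    · rw [if_pos (by simp [keepFrom]; omega), if_pos (by simp [keepFrom]; omega)]
      have h1 := cnt_lt h (P := keepFrom P m) (by simp [keepFrom])
      simp only [Expr.subst, if_neg h1.not_gt, if_neg h1.ne']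
      rw [cnt_keepFrom hm h]
      rfl

theorem chainTy_subst {m : ℕ} (hm : P m = false) (j : ℕ) :
    (chainTy c d (keepFrom P m) j).subst (cnt (keepFrom P m) m)
      (.app (d m) m fun i => chainArg d (keepFrom P m) i.1) =
    chainTy c d (keepFrom P (m + 1)) j := by
  simp only [chainTy, Expr.subst]
  congr 1
  funext i
  exact chainArg_subst d hm i.1

theorem chainCtx_subst {m : ℕ} (hm : P m = false) {N : ℕ} (h : m < N) :
    ∃ Δ, chainCtx c d (keepFrom P m) N =
        Δ ++ chainTy c d (keepFrom P m) m :: chainCtx c d (keepFrom P m) m ∧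
      chainCtx c d (keepFrom P (m + 1)) N = substCtx Δ (cnt (keepFrom P m) m)
        (.app (d m) m fun i => chainArg d (keepFrom P m) i.1) ++
          chainCtx c d (keepFrom P m) m := by
  induction h with
  | refl =>
    refine ⟨[], by simp [chainCtx, keepFrom], ?_⟩
    simp only [chainCtx]
    rw [if_neg (by simp [keepFrom, hm]), chainCtx_congr c d fun i hi => keepFrom_eq (by omega)]
    rfl
  | @step j h ih =>
    have h' : m < j := h
    obtain ⟨Δ, e1, e2⟩ := ih
    simp only [chainCtx]
    rw [if_pos (by simp [keepFrom]; omega), if_pos (by simp [keepFrom]; omega)]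
    refine ⟨chainTy c d (keepFrom P m) j :: Δ, by rw [e1]; rfl, ?_⟩
    rw [e2, ← chainTy_subst c d hm]
    rfl

theorem derives_chain_aux {Λ : Set (Judgement W)} {M : ℕ}
    (hc : ∀ N ≤ M, Derives Λ ⟨chainCtx c d (keepFrom P 0) N, .type (chainTy c d (keepFrom P 0) N)⟩)
    (hd : ∀ N < M, P N = false → Derives Λ ⟨chainCtx c d (keepFrom P 0) N,
      .term (.app (d N) N fun i => chainArg d (keepFrom P 0) i.1)
        (chainTy c d (keepFrom P 0) N)⟩) (m : ℕ) :
    (∀ N ≤ M, Derives Λ ⟨chainCtx c d (keepFrom P m) N, .type (chainTy c d (keepFrom P m) N)⟩) ∧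
    ∀ N ≤ M, ∀ w, Derives Λ ⟨chainCtx c d (keepFrom P 0) N,
        .term (.app w N fun i => chainArg d (keepFrom P 0) i.1) (chainTy c d (keepFrom P 0) N)⟩ →
      Derives Λ ⟨chainCtx c d (keepFrom P m) N,
        .term (.app w N fun i => chainArg d (keepFrom P m) i.1)
          (chainTy c d (keepFrom P m) N)⟩ := by
  induction m with
  | zero => exact ⟨hc, fun _ _ _ h => h⟩
  | succ m ih =>
    by_cases hm : P m = true
    · have : keepFrom P (m + 1) = keepFrom P m := by
        funext i
        by_cases hi : i = m
        · subst hi; simp [keepFrom, hm]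
        · exact keepFrom_eq hi
      rwa [this]
    have hm : P m = false := by simpa using hm
    have hle : ∀ N ≤ m, ∀ i < N, keepFrom P m i = keepFrom P (m + 1) i :=
      fun N hN i hi => (keepFrom_eq (by omega)).symm
    constructor
    · intro N hN
      rcases Nat.lt_or_ge m N with h | h
      · have ht := ih.2 m (by omega) (d m) (hd m (by omega) hm)
        obtain ⟨Δ, e1, e2⟩ := chainCtx_subst c d hm h
        have h2 := ih.1 N hN
        rw [e1] at h2
        have := Derives.subst Δ ht h2
        rw [length_chainCtx, ← e2, Body.subst, chainTy_subst c d hm] at this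
        exact this
      · rw [← chainCtx_congr c d (hle N h), ← chainTy_congr c d (hle N h)]
        exact ih.1 N hN
    · intro N hN w hw
      rcases Nat.lt_or_ge m N with h | h
      · have ht := ih.2 m (by omega) (d m) (hd m (by omega) hm)
        obtain ⟨Δ, e1, e2⟩ := chainCtx_subst c d hm h
        have h2 := ih.2 N hN w hw
        rw [e1] at h2
        have := Derives.subst Δ ht h2
        rw [length_chainCtx, ← e2, Body.subst, chainTy_subst c d hm] at this
        simp only [Expr.subst, chainArg_subst d hm] at this
        exact this
      · rw [← chainCtx_congr c d (hle N h), ← chainTy_congr c d (hle N h)]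
        have := ih.2 N hN w hw
        simp only [fun i : Fin N => chainArg_congr d (hle N h) i.1 i.2] at this
        exact this

theorem keepFrom_top {N : ℕ} : ∀ i < N, keepFrom P N i = P i := by
  intro i hi
  simp [keepFrom, hi]

theorem cnt_all (N : ℕ) : cnt (keepFrom P 0) N = N := by
  induction N with
  | zero => rfl
  | succ N ih => simp [cnt, ih, keepFrom]

theorem chainArg_all (N : ℕ) : chainArg d (keepFrom P 0) N = .var N := by
  rw [chainArg, if_pos (by simp [keepFrom]), cnt_all]

theorem chainCtx_skip {a b : ℕ} (h : a ≤ b) (hP : ∀ i, a ≤ i → i < b → P i = false) :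
    chainCtx c d P b = chainCtx c d P a := by
  induction h with
  | refl => rfl
  | @step b h ih =>
    have h' : a ≤ b := h
    rw [chainCtx, if_neg (by simp [hP b h' (by omega)]), ih fun i h1 h2 => hP i h1 (by omega)]

end Chain

/-- The constants and the kept variables agree with a labelled inc-list. -/
structure Compat {n : ℕ} (α : Inc n) (h : α.shape ⟶ X) (c d : ℕ → Alphabet X) (P : ℕ → Bool) :
    Prop where
  keep : ∀ j ≤ α.last, (P j = true ↔ j ∈ Set.range α)
  ty : ∀ j (hj : j ≤ α.last), c j = .inl ⟨j, lblTy h j hj⟩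
  tm : ∀ j (hj : j ≤ α.last) (hα : j ∉ Set.range α), d j = .inr ⟨j, lblTm h j hj hα⟩

open Classical in
theorem exists_compat {n : ℕ} (α : Inc n) (h : α.shape ⟶ X) : ∃ c d P, Compat α h c d P := by
  refine ⟨fun j => if hj : j ≤ α.last then .inl ⟨j, lblTy h j hj⟩
      else .inl ⟨α.last, lblTy h _ le_rfl⟩,
    fun j => if hj : j ≤ α.last ∧ j ∉ Set.range α then .inr ⟨j, lblTm h j hj.1 hj.2⟩
      else .inl ⟨α.last, lblTy h _ le_rfl⟩,
    fun j => decide (j ∈ Set.range α), ?_, ?_, ?_⟩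
  · intro j _; exact decide_eq_true_iff
  · intro j hj; exact dif_pos hj
  · intro j hj hα; exact dif_pos ⟨hj, hα⟩

section
variable {c d : ℕ → Alphabet X} {P : ℕ → Bool}

theorem cnt_skip {a b : ℕ} (h : a ≤ b) (hP : ∀ i, a ≤ i → i < b → P i = false) :
    cnt P b = cnt P a := by
  induction h with
  | refl => rfl
  | @step b h ih =>
    have h' : a ≤ b := h
    rw [cnt, if_neg (by simp [hP b h' (by omega)]), ih fun i h1 h2 => hP i h1 (by omega)]

namespace Compat

theorem res {n : ℕ} {α : Inc n} {h : α.shape ⟶ X} (hc : Compat α h c d P) (m : ℕ) (hm : m ≤ n) :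
    Compat (α.res m hm) (lblRes h m hm) c d P where
  keep j hj := (hc.keep j (hj.trans (α.last_res_le m hm))).trans (α.mem_range_res m hm hj).symm
  ty j hj := hc.ty j (hj.trans (α.last_res_le m hm))
  tm j hj hα := hc.tm j (hj.trans (α.last_res_le m hm))
    fun h' => hα ((α.mem_range_res m hm hj).2 h')

variable {n : ℕ} {α : Inc n} {h : α.shape ⟶ X}

theorem not_keep (hc : Compat α h c d P) {j : ℕ} (hj : j ≤ α.last) (h : ∀ p, α p ≠ j) : P j = false := by
  rw [← Bool.not_eq_true, hc.keep j hj]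
  rintro ⟨p, hp⟩
  exact h p hp

theorem cnt_val (hc : Compat α h c d P) : ∀ (p : ℕ) (hp : p < n + 1), cnt P (α ⟨p, hp⟩) = p
  | 0, hp => by
    rw [cnt_skip (Nat.zero_le _)]
    · rfl
    · intro i _ hi
      refine hc.not_keep (hi.le.trans (α.le_last _)) fun q hq => ?_
      rw [← hq, α.lt_iff_lt] at hi
      exact absurd hi (Nat.not_lt_zero _)
  | p + 1, hp => by
    have hlt : α ⟨p, by omega⟩ < α ⟨p + 1, hp⟩ := α.lt_iff_lt.2 (Nat.lt_succ_self p)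
    rw [cnt_skip (a := α ⟨p, by omega⟩ + 1) hlt, cnt,
      if_pos ((hc.keep _ (α.le_last _)).2 ⟨_, rfl⟩), cnt_val hc p]
    intro i h1 h2
    refine hc.not_keep (h2.le.trans (α.le_last _)) fun q hq => ?_
    rw [← hq, α.lt_iff_lt] at h2
    have h1' : α ⟨p, by omega⟩ < α q := by rw [hq]; exact h1
    rw [α.lt_iff_lt] at h1'
    have := Fin.lt_def.1 h1'
    have := Fin.lt_def.1 h2
    simp at *
    omega

theorem argExpr_eq (hc : Compat α h c d P) (j : ℕ) (hj : j ≤ α.last) : argExpr α h j hj = chainArg d P j := by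
  induction j using Nat.strong_induction_on with
  | _ j ih =>
    rw [argExpr, chainArg]
    by_cases hα : j ∈ Set.range α
    · rw [dif_pos hα, if_pos ((hc.keep j hj).2 hα)]
      congr 1
      have := hc.cnt_val (Classical.choose hα).1 (Classical.choose hα).2
      rw [← this]
      congr 1
      exact Classical.choose_spec hα
    · rw [dif_neg hα, if_neg (fun h => hα ((hc.keep j hj).1 h)), hc.tm j hj hα]
      congr 1
      funext i
      exact ih i.1 i.2 _

theorem typeExpr_eq (hc : Compat α h c d P) : typeExpr α h = chainTy c d P α.last := by
  rw [typeExpr, chainTy, hc.ty _ le_rfl]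
  congr 1
  funext i
  exact hc.argExpr_eq _ _

theorem termExpr_eq (hc : Compat α h c d P) (a) :
    termExpr α h a = .app (.inr ⟨α.last, a.1⟩) α.last fun i => chainArg d P i.1 := by
  rw [termExpr]
  congr 1
  funext i
  exact hc.argExpr_eq _ _

theorem chainTy_all (hc : Compat α h c d P) (N : ℕ) (hN : N ≤ α.last) :
    chainTy c d (keepFrom P 0) N = genTy X (lblTy h N hN) := by
  rw [chainTy, hc.ty N hN]
  simp only [chainArg_all]
  rfl

theorem chainCtx_all (hc : Compat α h c d P) (N : ℕ) (hN : N ≤ α.last) :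
    chainCtx c d (keepFrom P 0) N = genCtx X (lblTy h N hN) := by
  induction N with
  | zero => rfl
  | succ N ih =>
    rw [chainCtx, if_pos (by simp [keepFrom]), genCtx, bdTy_lblTy, ih, hc.chainTy_all]

theorem ctxOf_eq : ∀ {n : ℕ} {α : Inc n} {h : α.shape ⟶ X}, Compat α h c d P →
    ctxOf α h = chainCtx c d P α.last
  | 0, α, h, hc => by
    rw [ctxOf, chainCtx_skip c d (Nat.zero_le _)]
    · rfl
    · intro i _ hi
      refine hc.not_keep hi.le fun q hq => ?_
      rw [← hq] at hi
      have : q = Fin.last 0 := Fin.ext (by have := q.2; simp)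
      subst this
      exact lt_irrefl _ hi
  | n + 1, α, h, hc => by
    have hres := hc.res n n.le_succ
    have hlt : (α.res n n.le_succ).last < α.last := α.lt_iff_lt.2 (Nat.lt_succ_self n)
    rw [ctxOf, ctxOf_eq hres, hres.typeExpr_eq,
      chainCtx_skip c d (a := (α.res n n.le_succ).last + 1) hlt, chainCtx,
      if_pos ((hres.keep _ le_rfl).2 ⟨Fin.last n, rfl⟩)]
    intro i h1 h2
    refine hc.not_keep h2.le fun q hq => ?_
    rw [← hq] at h1 h2
    have h1' : (⟨n, by omega⟩ : Fin (n + 1 + 1)) < q := α.lt_iff_lt.1 h1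
    have h2' : q < Fin.last (n + 1) := α.lt_iff_lt.1 h2
    have h1'' : n < q.1 := h1'
    have h2'' : q.1 < n + 1 := h2'
    omega

theorem derives_basic (hc : Compat α h c d P) : ∀ N ≤ α.last, Derives (freeBasic X)
    ⟨chainCtx c d (keepFrom P 0) N, .type (chainTy c d (keepFrom P 0) N)⟩ := by
  intro N hN
  rw [hc.chainCtx_all N hN, hc.chainTy_all N hN]
  exact derives_genTyJ X _

theorem derives_term (hc : Compat α h c d P) {N : ℕ} (hN : N ≤ α.last) (a : X.Tm N) (ha : X.bdTm a = lblTy h N hN) :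
    Derives (freeBasic X) ⟨chainCtx c d (keepFrom P 0) N,
      .term (.app (.inr ⟨N, a⟩) N fun i => chainArg d (keepFrom P 0) i.1)
        (chainTy c d (keepFrom P 0) N)⟩ := by
  rw [hc.chainCtx_all N hN, hc.chainTy_all N hN]
  simp only [chainArg_all]
  rw [← ha]
  exact derives_genTmJ X a

theorem derives_at (hc : Compat α h c d P) {N : ℕ} (hN : N < α.last) (hP : P N = false) :
    Derives (freeBasic X) ⟨chainCtx c d (keepFrom P 0) N,
      .term (.app (d N) N fun i => chainArg d (keepFrom P 0) i.1)
        (chainTy c d (keepFrom P 0) N)⟩ := by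
  have hα : N ∉ Set.range α := by
    rw [← hc.keep N hN.le, hP]; simp
  rw [hc.tm N hN.le hα]
  exact hc.derives_term hN.le _ (bdTm_lblTm h N hN.le hα)

theorem derives_typeJ (hc : Compat α h c d P) : Derives (freeBasic X) ⟨ctxOf α h, .type (typeExpr α h)⟩ := by
  have := (derives_chain_aux c d hc.derives_basic (fun _ => hc.derives_at) α.last).1 _ le_rfl
  rw [chainCtx_congr c d keepFrom_top, chainTy_congr c d keepFrom_top] at this
  rwa [hc.ctxOf_eq, hc.typeExpr_eq]

theorem derives_termJ (hc : Compat α h c d P) (a) :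
    Derives (freeBasic X) ⟨ctxOf α h, .term (termExpr α h a) (typeExpr α h)⟩ := by
  have := (derives_chain_aux c d hc.derives_basic (fun _ => hc.derives_at) α.last).2 _ le_rfl _ (hc.derives_term le_rfl a.1 a.2)
  rw [chainCtx_congr c d keepFrom_top, chainTy_congr c d keepFrom_top] at this
  have e : (fun i : Fin α.last => chainArg d (keepFrom P α.last) i.1) =
      fun i => chainArg d P i.1 := funext fun i => chainArg_congr d keepFrom_top i.1 i.2
  rw [e] at this
  rwa [hc.ctxOf_eq, hc.typeExpr_eq, hc.termExpr_eq]

end Compat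
end

/-- The type-element `(α, h)` of the free theory on `X`, for an inc-list `α` and `h : [α] ⟶ X`:
the class of the judgement of shape `α` and labelling `h`. -/
noncomputable def tyElem {n : ℕ} (α : Inc n) (h : α.shape ⟶ X) : (substMonad.obj X).Ty n :=
  (freeGAT X).tyMk ⟨⟨⟨ctxOf α h, .type (typeExpr α h)⟩,
    (let ⟨_, _, _, hc⟩ := exists_compat α h; hc.derives_typeJ)⟩, rfl,
      congrArg (· + 1) (length_ctxOf α h)⟩

theorem bdTy_tyElem {n : ℕ} (α : Inc (n + 1)) (h : α.shape ⟶ X) :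
    (substMonad.obj X).bdTy (tyElem α h) = tyElem (α.res n n.le_succ) (lblRes h n n.le_succ) :=
  rfl

/-- The term-element over `(α, h)` given by a term-element of `X` over `h(α(n))`. -/
noncomputable def tmElem {n : ℕ} (α : Inc n) (h : α.shape ⟶ X)
    (a : X.TmOver (lblTy h α.last le_rfl)) : (substMonad.obj X).TmOver (tyElem α h) :=
  ⟨(freeGAT X).tmMk ⟨⟨⟨ctxOf α h, .term (termExpr α h a) (typeExpr α h)⟩,
    (let ⟨_, _, _, hc⟩ := exists_compat α h; hc.derives_termJ a)⟩, rfl,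
      congrArg (· + 1) (length_ctxOf α h)⟩, rfl⟩

end Elements

/-! ## Elements of the square of the substitution monad -/

/-- Composition of inc-lists: `(βα)(i) = β(α(i))`, where the length of `β` is the last value
of `α`. -/
def Inc.comp {n : ℕ} (α : Inc n) (β : Inc α.last) : Inc n :=
  OrderEmbedding.ofStrictMono (fun i => β ⟨α i, Nat.lt_succ_of_le (α.le_last i)⟩)
    fun _ _ h => β.strictMono (α.strictMono h)

theorem Inc.res_self {n : ℕ} (β : Inc n) : β.res n le_rfl = β := rfl

theorem lblRes_self {X : Struct.{u}} {n : ℕ} {β : Inc n} (h : β.shape ⟶ X) :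
    lblRes h n le_rfl = h :=
  Struct.hom_ext (X := β.shape) (Y := X) (fun _ _ => rfl) (fun _ _ => rfl)

theorem lblRes_lblRes {X : Struct.{u}} {n : ℕ} {β : Inc n} (h : β.shape ⟶ X) (m : ℕ) (hm : m ≤ n)
    (k : ℕ) (hk : k ≤ m) :
    lblRes (α := β.res m hm) (lblRes h m hm) k hk = lblRes h k (hk.trans hm) :=
  Struct.hom_ext (X := (β.res k (hk.trans hm)).shape) (Y := X) (fun _ _ => rfl) (fun _ _ => rfl)

/-- The data `(α, (β, h, k))`. -/
structure SqCode (X : Struct.{u}) (n : ℕ) : Type u where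
  α : Inc n
  β : Inc α.last
  h : β.shape ⟶ X
  k : ∀ (j : ℕ) (hj : j ≤ α.last), j ∉ Set.range α →
    X.TmOver (lblTy h (β ⟨j, Nat.lt_succ_of_le hj⟩) (β.le_last _))

namespace SqCode
variable {X : Struct.{u}} {n : ℕ} (s : SqCode X n)

/-- The map `(β, h, k) : [α] ⟶ SX`: on type-elements it is given by the iterated boundaries of
`(β, h)`, and on term-elements by `k`. -/
noncomputable def label : s.α.shape ⟶ substMonad.obj X :=
  Struct.homMk (X := s.α.shape) (Y := substMonad.obj X)
    (fun j x => tyElem (s.β.res j x.down.down) (lblRes s.h j x.down.down))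
    (fun j x => (tmElem (s.β.res j x.down.down.1) (lblRes s.h j x.down.down.1)
      (s.k j x.down.down.1 x.down.down.2)).1)
    (fun j x => congrArg (tyElem (s.β.res j (j.le_succ.trans x.down.down)))
      (lblRes_lblRes s.h (j + 1) x.down.down j j.le_succ))
    (fun j x => (tmElem (s.β.res j x.down.down.1) (lblRes s.h j x.down.down.1)
      (s.k j x.down.down.1 x.down.down.2)).2)

theorem lblTy_label_last : lblTy s.label s.α.last le_rfl = tyElem s.β s.h :=
  congrArg (tyElem s.β) (lblRes_self s.h)

/-- The type-element `(α, (β, h, k))` of `S²X`. -/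
noncomputable def ty : (substMonad.obj (substMonad.obj X)).Ty n := tyElem s.α s.label

/-- The term-element of `S²X` over `(α, (β, h, k))` given by a term-element of `X` over
`h(β(α(n)))`. -/
noncomputable def tm (a : X.TmOver (lblTy s.h s.β.last le_rfl)) :
    (substMonad.obj (substMonad.obj X)).TmOver s.ty :=
  tmElem s.α s.label
    ⟨(tmElem s.β s.h a).1, (tmElem s.β s.h a).2.trans s.lblTy_label_last.symm⟩

/-- The inc-list `βα`. -/
def comp : Inc n := s.α.comp s.β

open Classical in
/-- The term-element `(h ∪ k)(i_t)`: it is `h(i_t)` if `i` is not a value of `β`, and `k(j)`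
if `i = β(j)`, where `j` is not a value of `α`. -/
noncomputable def unionTm (i : ℕ) (hi : i ≤ s.β.last) (hi' : i ∉ Set.range s.comp) :
    X.TmOver (lblTy s.h i hi) :=
  if hβ : ∃ q, s.β q = i then
    have e : s.β (Classical.choose hβ) = i := Classical.choose_spec hβ
    have hα : (Classical.choose hβ).1 ∉ Set.range s.α := by
      rintro ⟨p, hp⟩
      exact hi' ⟨p, Eq.trans (congrArg s.β (Fin.ext hp)) e⟩
    e.rec (motive := fun i' _ => (hi' : i' ≤ s.β.last) → X.TmOver (lblTy s.h i' hi'))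
      (fun _ => s.k (Classical.choose hβ).1 (Nat.le_of_lt_succ (Classical.choose hβ).2) hα) hi
  else ⟨lblTm s.h i hi fun h => hβ (Set.mem_range.1 h),
    bdTm_lblTm s.h i hi fun h => hβ (Set.mem_range.1 h)⟩

theorem unionTm_of_notMem (i : ℕ) (hi : i ≤ s.β.last) (hi' : i ∉ Set.range s.comp)
    (hβ : i ∉ Set.range s.β) : (s.unionTm i hi hi').1 = lblTm s.h i hi hβ :=
  congrArg Subtype.val (dif_neg fun h => hβ (Set.mem_range.2 h))

theorem unionTm_val (j : ℕ) (hj : j ≤ s.α.last) (hα : j ∉ Set.range s.α)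
    (hi : s.β ⟨j, Nat.lt_succ_of_le hj⟩ ≤ s.β.last)
    (hi' : s.β ⟨j, Nat.lt_succ_of_le hj⟩ ∉ Set.range s.comp) :
    s.unionTm (s.β ⟨j, Nat.lt_succ_of_le hj⟩) hi hi' = s.k j hj hα := by
  have hβ : ∃ q, s.β q = s.β ⟨j, Nat.lt_succ_of_le hj⟩ := ⟨_, rfl⟩
  have key : ∀ (q : Fin (s.α.last + 1)) (e : s.β q = s.β ⟨j, Nat.lt_succ_of_le hj⟩)
      (hα' : q.1 ∉ Set.range s.α),
      (e.rec (motive := fun i' _ => (hi' : i' ≤ s.β.last) → X.TmOver (lblTy s.h i' hi'))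
        (fun _ => s.k q.1 (Nat.le_of_lt_succ q.2) hα') hi :
          X.TmOver (lblTy s.h (s.β ⟨j, Nat.lt_succ_of_le hj⟩) hi)) = s.k j hj hα := by
    intro q e hα'
    obtain rfl := s.β.injective e
    rfl
  exact (dif_pos hβ).trans (key _ _ _)

/-- The map `h ∪ k : [βα] ⟶ X`. -/
noncomputable def union : s.comp.shape ⟶ X :=
  Struct.homMk (X := s.comp.shape) (Y := X)
    (fun i x => lblTy s.h i x.down.down)
    (fun i x => (s.unionTm i x.down.down.1 x.down.down.2).1)
    (fun i x => bdTy_lblTy s.h i x.down.down)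
    (fun i x => (s.unionTm i x.down.down.1 x.down.down.2).2)

end SqCode

end SubstMonad

open SubstMonad

namespace SubstMonad

/-! ## Judgements of the free theory -/

/-! The free theory `freeGAT X` has no equality axioms, so both sides of any derivable equality are
literally the same expression (`free_eq`). Hence provable equality of type and term judgements is
equality of judgements (`eq_of_congr_free`), every class has a single representative, and the
elements of `SX` are the derivable judgements themselves. The theorem becomes a statement about
normal forms of expressions.

Normal forms. A basic judgement carries a chain of type-constants, the successive boundaries of its
last type, with a variable at each position. Substitution is the only rule that produces a new type
or term judgement, and it does one thing: it turns a kept position `m` into an eliminated one,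
occupied by a term-constant applied to the expressions at the earlier positions. The reason is that
the substituted term must have the type found at position `m`; that type displays its head constant
and all its arguments, so the term is a term-element over the right type-element, applied to exactly
the arguments already present. By induction every derivable type or term judgement is a labelled
chain (`isChain_of_derives`). The kept positions, followed by the last one, form the inc-list `α`,
and the constants form the labelling `h`. This gives surjectivity of `tyElem` and `tmElem`.

Uniqueness. The last type alone determines `(α, h)`: its `j`-th argument is a variable exactly when
`j` is a value of `α`, otherwise the head of that argument is `h(j_t)`; the head of the type is the
top label, and the other type labels are its iterated boundaries (`typeExpr_injective`). Applying
the classification first over `SX` and then over `X` gives the elements of `S²X`, since a labelling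
in `SX` is determined by its top type label, which is some `(β, h)`, and by its term labels, which
are term-elements `k`.

Multiplication. The counit at `GX` is the translation that replaces each constant by a
representative judgement (`substMonad_μ_app`). Representatives are unique, so the chosen ones must
be the normal forms. Translating `(α, (β, h, k))` therefore substitutes the expressions of `α` for
the variables of `(β, h)`. A position outside the image of `β` keeps its label from `h`. A position
`β(j)` becomes a variable if `j` is a value of `α`, and otherwise receives the normal form of
`k(j)`, whose arguments are again those of `(β, h)`. This is the recursion that defines the
expressions of `(βα, h ∪ k)` (`SqCode.argExpr_bind`), and by uniqueness it is enough to compare the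
last types and the terms. -/

theorem Expr.app_inj {W : Type u} {w w' : W} {n n' : ℕ} {s : Fin n → Expr W} {s' : Fin n' → Expr W}
    (h : Expr.app w n s = .app w' n' s') :
    w = w' ∧ n = n' ∧ ∀ i (hi : i < n) (hi' : i < n'), s ⟨i, hi⟩ = s' ⟨i, hi'⟩ := by
  cases h
  exact ⟨rfl, rfl, fun _ _ _ => rfl⟩

section
variable {X : Struct.{u}}

theorem eq_of_ctxEq_free {Γ Γ' : List (Expr (Alphabet X))} (h : CtxEq (freeBasic X) Γ Γ') :
    Γ = Γ' := by
  induction h with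
  | nil => rfl
  | cons _ h ih => rw [ih, show _ = _ from free_eq h]

/-- Provable equality in the free theory is equality of judgements. -/
theorem eq_of_congr_free {J K : Judgement (Alphabet X)} (h : Congr (freeBasic X) J K) :
    J = K := by
  match J, K, h with
  | ⟨Γ, .type T⟩, ⟨Γ', .type T'⟩, h => cases eq_of_ctxEq_free h; rfl
  | ⟨Γ, .term t T⟩, ⟨Γ', .term t' T'⟩, ⟨h, ht⟩ =>
    cases eq_of_ctxEq_free h
    cases (show t = t' from free_eq ht)
    rfl

/-- The constants `c`, `d` label the chain of length `N` with kept variables `P`, the type-constants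
being the successive boundaries of a type-element. -/
structure IsChain (c d : ℕ → Alphabet X) (P : ℕ → Bool) (N : ℕ) (A : ∀ j ≤ N, X.Ty j) : Prop where
  bd : ∀ j (hj : j + 1 ≤ N), X.bdTy (A (j + 1) hj) = A j (Nat.le_of_succ_le hj)
  ty : ∀ j (hj : j ≤ N), c j = .inl ⟨j, A j hj⟩
  tm : ∀ j (hj : j < N), P j = false → ∃ a, X.bdTm a = A j hj.le ∧ d j = .inr ⟨j, a⟩

/-- The type and term judgements that come from labelled chains. -/
def Judgement.IsChain (J : Judgement (Alphabet X)) : Prop :=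
  ∃ c d P N A, SubstMonad.IsChain c d P N A ∧ J.ctx = chainCtx c d P N ∧
    match J.body with
    | .type T => T = chainTy c d P N
    | .term t T => T = chainTy c d P N ∧ ∃ a, X.bdTm a = A N le_rfl ∧
        t = .app (.inr ⟨N, a⟩) N fun i => chainArg d P i.1
    | _ => True

end

/-! ### Eliminating one kept variable of a chain -/

section
variable {W : Type u} {c d : ℕ → W} {P : ℕ → Bool}

/-- Context entries are contributed exactly by the kept positions. This locates the position of the
variable that a substitution removes. -/
theorem exists_of_chainCtx_eq_append {N : ℕ} {Δ Γ : List (Expr W)} {T : Expr W}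
    (h : chainCtx c d P N = Δ ++ T :: Γ) :
    ∃ m < N, P m = true ∧ Γ = chainCtx c d P m ∧ T = chainTy c d P m := by
  induction N generalizing Δ with
  | zero => simp [chainCtx] at h
  | succ N ih =>
    rw [chainCtx] at h
    split_ifs at h with hP
    · rcases Δ with _ | ⟨D, Δ⟩
      · simp only [List.nil_append, List.cons.injEq] at h
        exact ⟨N, N.lt_succ_self, hP, h.2.symm, h.1.symm⟩
      · simp only [List.cons_append, List.cons.injEq] at h
        obtain ⟨m, hm, h'⟩ := ih h.2
        exact ⟨m, hm.trans N.lt_succ_self, h'⟩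
    · obtain ⟨m, hm, h'⟩ := ih h
      exact ⟨m, hm.trans N.lt_succ_self, h'⟩

variable (d) {m : ℕ} (w : W)

theorem update_false_of_ne {j : ℕ} (h : j ≠ m) : Function.update P m false j = P j :=
  Function.update_of_ne h _ _

theorem cnt_update_le {j : ℕ} (h : j ≤ m) : cnt (Function.update P m false) j = cnt P j :=
  cnt_congr fun _ hi => update_false_of_ne (by omega)

/-- Dropping position `m` lowers the index of every later variable by one, which matches the shift
built into `Expr.subst`. -/
theorem cnt_update_lt (hm : P m = true) {j : ℕ} (h : m < j) :
    cnt P j = cnt (Function.update P m false) j + 1 := by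
  induction h with
  | refl => simp [cnt, hm, cnt_update_le (P := P) (le_refl m)]
  | @step j h ih =>
    have h' : m < j := h
    simp only [cnt]
    rw [update_false_of_ne (by omega : j ≠ m), ih]
    split_ifs <;> rfl

/-- The expression at position `j` consults only positions up to `j`, so a change at a later `m` is
invisible. -/
theorem chainArg_update_congr {j : ℕ} (h : j < m) :
    chainArg (Function.update d m w) (Function.update P m false) j = chainArg d P j := by
  induction j using Nat.strong_induction_on with
  | _ j ih =>
    rw [chainArg, chainArg, update_false_of_ne h.ne, Function.update_of_ne h.ne,
      cnt_update_le h.le]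
    congr 2
    funext i
    exact ih i.1 i.2 (i.2.trans h)

/-- Induction along the recursion for `chainArg`: position `m` turns from a variable into the
substituted term, variables before it stay, those after it shift down, and at an eliminated position
the substitution passes to the arguments. Unlike in `chainArg_subst`, positions after `m` may
already have been eliminated, so this covers an arbitrary use of the substitution rule. -/
theorem chainArg_update (hm : P m = true) (j : ℕ) :
    (chainArg d P j).subst (cnt P m) (.app w m fun i => chainArg d P i.1) =
      chainArg (Function.update d m w) (Function.update P m false) j := by
  induction j using Nat.strong_induction_on with
  | _ j ih =>
    rw [chainArg, chainArg]
    rcases eq_or_ne j m with rfl | hj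
    · rw [if_pos hm, if_neg (by simp)]
      simp only [Expr.subst, lt_irrefl, if_false, if_true, Function.update_self]
      congr 1
      funext i
      exact (chainArg_update_congr d w i.2).symm
    · rw [update_false_of_ne hj, Function.update_of_ne hj]
      split_ifs with hP
      · rcases lt_or_gt_of_ne hj with h | h
        · simp only [Expr.subst, if_pos (cnt_lt h hP), cnt_update_le (P := P) h.le]
        · have h1 := cnt_lt h hm
          simp only [Expr.subst, if_neg h1.not_gt, if_neg h1.ne']
          rw [cnt_update_lt hm h, Nat.add_sub_cancel]
      · simp only [Expr.subst]
        congr 1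
        funext i
        exact ih i.1 i.2

theorem chainTy_update (hm : P m = true) (j : ℕ) :
    (chainTy c d P j).subst (cnt P m) (.app w m fun i => chainArg d P i.1) =
      chainTy c (Function.update d m w) (Function.update P m false) j := by
  simp only [chainTy, Expr.subst]
  congr 1
  funext i
  exact chainArg_update d w hm i.1

theorem chainTy_update_congr {j : ℕ} (h : j ≤ m) :
    chainTy c (Function.update d m w) (Function.update P m false) j = chainTy c d P j := by
  simp only [chainTy]
  congr 1
  funext i
  exact chainArg_update_congr d w (i.2.trans_le h)

theorem chainCtx_update_congr {j : ℕ} (h : j ≤ m) :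
    chainCtx c (Function.update d m w) (Function.update P m false) j = chainCtx c d P j := by
  induction j with
  | zero => rfl
  | succ j ih =>
    rw [chainCtx, chainCtx, ih (by omega), update_false_of_ne (by omega),
      chainTy_update_congr d w (by omega)]

/-- Here `Δ` is prescribed by an instance of the rule, so the induction on `N` must peel off its
entries one kept position at a time. -/
theorem chainCtx_update (hm : P m = true) {N : ℕ} (h : m < N) {Δ : List (Expr W)}
    (e : chainCtx c d P N = Δ ++ chainTy c d P m :: chainCtx c d P m) :
    substCtx Δ (cnt P m) (.app w m fun i => chainArg d P i.1) ++ chainCtx c d P m =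
      chainCtx c (Function.update d m w) (Function.update P m false) N := by
  induction h generalizing Δ with
  | refl =>
    rw [chainCtx, if_pos hm] at e
    obtain rfl : Δ = [] := by simpa using congrArg List.length e
    rw [chainCtx, if_neg (by simp), chainCtx_update_congr d w le_rfl]
    rfl
  | @step j h ih =>
    have h' : m < j := h
    rw [chainCtx] at e
    rw [chainCtx, update_false_of_ne h'.ne']
    split_ifs at e ⊢ with hP
    · rcases Δ with _ | ⟨D, Δ⟩
      -- `Δ` cannot be empty: the kept position `j` after `m` contributes an entry, so the two
      -- contexts would have different lengths.
      · have := congrArg List.length e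
        have h2 := cnt_lt h' hm
        simp [length_chainCtx] at this
        omega
      · simp only [List.cons_append, List.cons.injEq] at e
        rw [← ih e.2, ← chainTy_update d w hm, ← e.1]
        rfl
    · exact ih e

end

/-! ### Derivable judgements of the free theory are labelled chains -/

section
variable {X : Struct.{u}}

theorem IsChain.update {c d : ℕ → Alphabet X} {P N A} (h : IsChain c d P N A) {m : ℕ} (hm : m < N)
    {a : X.Tm m} (ha : X.bdTm a = A m hm.le) :
    IsChain c (Function.update d m (.inr ⟨m, a⟩)) (Function.update P m false) N A where
  bd := h.bd
  ty := h.ty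
  tm j hj hP := by
    rcases eq_or_ne j m with rfl | hjm
    · exact ⟨a, ha, Function.update_self ..⟩
    · rw [update_false_of_ne hjm] at hP
      rw [Function.update_of_ne hjm]
      exact h.tm j hj hP

/-- The successive boundaries of a type-element. -/
theorem exists_bdIter {N : ℕ} (B : X.Ty N) : ∃ A : ∀ j ≤ N, X.Ty j, A N le_rfl = B ∧
    ∀ j (hj : j + 1 ≤ N), X.bdTy (A (j + 1) hj) = A j (Nat.le_of_succ_le hj) := by
  induction N with
  | zero => exact ⟨fun j hj => (Nat.le_zero.1 hj) ▸ B, rfl, fun j hj => absurd hj (by omega)⟩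
  | succ N ih =>
    obtain ⟨A, e, hA⟩ := ih (X.bdTy B)
    refine ⟨fun j hj => if h : j ≤ N then A j h else (show N + 1 = j by omega) ▸ B, ?_, ?_⟩
    · exact dif_neg (by omega)
    · intro j hj
      rcases Nat.lt_or_ge j N with h | h
      · simp only [dif_pos h.le, dif_pos (show j + 1 ≤ N from h)]
        exact hA j h
      · obtain rfl : j = N := by omega
        simp only [le_refl, dif_pos, dif_neg (Nat.not_succ_le_self j)]
        exact e.symm

/-- With every position kept, the expression at position `k` is the variable `k`, so the chain on
the iterated boundaries of `B` is the generic one. This is the base case of the classification. -/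
theorem exists_isChain_all {N : ℕ} (B : X.Ty N) : ∃ c d A, IsChain (X := X) c d (fun _ => true) N A ∧
    A N le_rfl = B ∧ genCtx X B = chainCtx c d (fun _ => true) N ∧
    ∀ w, Expr.generic w N = .app w N fun i => chainArg d (fun _ => true) i.1 := by
  obtain ⟨A, e, hA⟩ := exists_bdIter B
  -- The constant `B` is only a filler: `c` is never consulted above `N`, and `d` never at all,
  -- because no position is eliminated.
  refine ⟨fun j => if hj : j ≤ N then .inl ⟨j, A j hj⟩ else .inl ⟨N, B⟩, fun _ => .inl ⟨N, B⟩, A,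
    ⟨hA, fun j hj => dif_pos hj, fun _ _ h => by cases h⟩, e, ?_, ?_⟩
  all_goals
    have hcnt : ∀ k, cnt (fun _ => true) k = k := fun k => by
      induction k with
      | zero => rfl
      | succ k ih => simp [cnt, ih]
    have harg : ∀ k, chainArg (fun _ => (.inl ⟨N, B⟩ : Alphabet X)) (fun _ => true) k = .var k :=
      fun k => by rw [chainArg, if_pos rfl, hcnt]
  · have : ∀ k (hk : k ≤ N), genCtx X (A k hk) = chainCtx
        (fun j => if hj : j ≤ N then (.inl ⟨j, A j hj⟩ : Alphabet X) else .inl ⟨N, B⟩)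
        (fun _ => .inl ⟨N, B⟩) (fun _ => true) k := fun k => by
      induction k with
      | zero => exact fun _ => rfl
      | succ k ih =>
        intro hk
        rw [genCtx, hA, ih, chainCtx, if_pos rfl, chainTy]
        simp only [harg, dif_pos (Nat.le_of_succ_le hk)]
        rfl
    conv_lhs => rw [← e]
    exact this N le_rfl
  · intro w
    simp only [harg]
    rfl

theorem isChain_genTyJ {N : ℕ} (B : X.Ty N) : (genTyJ X B).IsChain := by
  obtain ⟨c, d, A, h, e, hc, hw⟩ := exists_isChain_all B
  refine ⟨c, d, _, N, A, h, hc, ?_⟩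
  change genTy X B = _
  rw [genTy, chainTy, h.ty _ le_rfl, hw, e]

theorem isChain_genTmJ {N : ℕ} (a : X.Tm N) : (genTmJ X a).IsChain := by
  obtain ⟨c, d, A, h, e, hc, hw⟩ := exists_isChain_all (X.bdTm a)
  refine ⟨c, d, _, N, A, h, hc, ?_, a, e.symm, ?_⟩
  · rw [genTy, chainTy, h.ty _ le_rfl, hw, e]
  · rw [genTm, hw]

/-- Substitution of a term chain in a type or term chain. -/
theorem isChain_subst {Γ Δ : List (Expr (Alphabet X))} {t T b}
    (h₁ : Judgement.IsChain ⟨Γ, .term t T⟩) (h₂ : Judgement.IsChain ⟨Δ ++ T :: Γ, b⟩)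
    (hb : b.form = .type ∨ b.form = .term) :
    Judgement.IsChain ⟨substCtx Δ Γ.length t ++ Γ, b.subst Γ.length t⟩ := by
  obtain ⟨c₁, d₁, P₁, N₁, A₁, h₁, -, hT₁, a, ha, rfl⟩ := h₁
  obtain ⟨c, d, P, N, A, h, hctx, hbody⟩ := h₂
  obtain ⟨m, hm, hP, rfl, rfl⟩ := exists_of_chainCtx_eq_append hctx.symm
  -- The type `T` is both the `m`-th type of the second chain and the last type of the first.
  -- Comparing heads gives `N₁ = m` and the same type-element; comparing arguments shows that the
  -- term is `a` applied to the expressions of the second chain. This is the form required for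
  -- eliminating position `m`.
  rw [chainTy, chainTy] at hT₁
  obtain ⟨hw, rfl, hargs⟩ := Expr.app_inj hT₁
  rw [h.ty _ hm.le, h₁.ty _ le_rfl] at hw
  have hA : A m hm.le = A₁ m le_rfl := by
    simpa using hw
  have hargs' : (fun i : Fin m => chainArg d₁ P₁ i.1) = fun i => chainArg d P i.1 :=
    funext fun i => (hargs i.1 i.2 i.2).symm
  rw [hargs', length_chainCtx]
  refine ⟨c, _, _, N, A, h.update hm (ha.trans hA.symm), chainCtx_update d _ hP hm hctx.symm, ?_⟩
  match b, hb, hbody with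
  | .type S, _, hbody =>
    obtain rfl : S = chainTy c d P N := hbody
    exact chainTy_update d _ hP N
  | .term s S, _, hbody =>
    obtain ⟨rfl, a', ha', rfl⟩ : S = chainTy c d P N ∧ _ := hbody
    refine ⟨chainTy_update d _ hP N, a', ha', ?_⟩
    simp only [Expr.subst]
    congr 1
    funext i
    exact chainArg_update d _ hP i.1

/-- Derivable type and term judgements of the free theory come from labelled chains. -/
theorem isChain_of_derives {J : Judgement (Alphabet X)} (h : Derives (freeBasic X) J)
    (hJ : J.IsTypeOrTerm) : J.IsChain := by
  induction h with
  | basic J hΛ _ _ =>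
    obtain ⟨n, A, rfl⟩ | ⟨n, a, rfl⟩ := hΛ
    · exact isChain_genTyJ A
    · exact isChain_genTmJ a
  | rule r Js J hr hd ih =>
    cases hr <;>
      simp only [List.mem_cons, List.not_mem_nil, or_false, forall_eq_or_imp, forall_eq] at ih hd
    -- A conversion along a derivable equality changes nothing, since the two types coincide.
    case termConv Γ T₁ T₂ t =>
      obtain rfl : T₁ = T₂ := free_eq hd.1
      exact ih.2 hJ
    case ctxConv Γ T₁ T₂ Δ b =>
      obtain rfl : T₁ = T₂ := free_eq hd.1
      exact ih.2 hJ
    case subst Γ t T Δ b =>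
      have hb : b.form = .type ∨ b.form = .term := by
        cases b <;> exact hJ
      exact isChain_subst (ih.1 (.inr rfl)) (ih.2 hb) hb
    all_goals simp [Judgement.IsTypeOrTerm, Body.form] at hJ

end


/-! ### From chains to inc-lists: existence and uniqueness of normal forms -/

section
variable {X : Struct.{u}}

/-- The inc-list of the kept positions below `N`, followed by `N`. -/
theorem exists_inc (P : ℕ → Bool) (N : ℕ) {n : ℕ} (hn : cnt P N = n) : ∃ α : Inc n, α.last = N ∧
    ∀ j < N, (j ∈ Set.range α ↔ P j = true) := by
  have hs : ∀ N, ((Finset.range N).filter fun j => P j = true).card = cnt P N := fun N => by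
    induction N with
    | zero => rfl
    | succ N ih =>
      rw [Finset.range_add_one, Finset.filter_insert, cnt]
      split_ifs
      · rw [Finset.card_insert_of_notMem (by simp), ih]
      · exact ih
  -- `N` is added whatever the value of `P N`: it marks the last type, whose context and arguments
  -- only involve positions below `N`.
  have hN : (insert N ((Finset.range N).filter fun j => P j = true)).card = n + 1 := by
    rw [Finset.card_insert_of_notMem (by simp), hs, hn]
  refine ⟨Finset.orderEmbOfFin _ hN, ?_, fun j hj => ?_⟩
  · apply le_antisymm
    · have := Finset.orderEmbOfFin_mem _ hN (Fin.last _)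
      simp only [Finset.mem_insert, Finset.mem_filter, Finset.mem_range] at this
      exact this.elim le_of_eq fun h => h.1.le
    · have : N ∈ Set.range (Finset.orderEmbOfFin _ hN) := by
        rw [Finset.range_orderEmbOfFin]; simp
      obtain ⟨p, hp⟩ := this
      exact hp.symm.trans_le (Inc.le_last _ p)
  · rw [Finset.range_orderEmbOfFin]
    simp [hj, hj.ne]

/-- A labelled chain gives a labelling of the inc-list of its kept positions. -/
theorem IsChain.exists_compat {c d : ℕ → Alphabet X} {P : ℕ → Bool} {n : ℕ} {α : Inc n} {A}
    (h : IsChain c d P α.last A) (hα : ∀ j < α.last, (j ∈ Set.range α ↔ P j = true)) :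
    ∃ (g : α.shape ⟶ X) (Q : ℕ → Bool), Compat α g c d Q ∧ (∀ j < α.last, P j = Q j) ∧
      lblTy g α.last le_rfl = A α.last le_rfl := by
  have hlt : ∀ j ≤ α.last, j ∉ Set.range α → j < α.last := fun j hj h' =>
    lt_of_le_of_ne hj fun e => h' ⟨Fin.last n, e.symm⟩
  have htm : ∀ j (hj : j ≤ α.last ∧ j ∉ Set.range α), ∃ a, X.bdTm a = A j hj.1 ∧
      d j = .inr ⟨j, a⟩ := fun j hj =>
    h.tm j (hlt j hj.1 hj.2) (by
      rw [← Bool.not_eq_true, ← hα j (hlt j hj.1 hj.2)]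
      exact hj.2)
  choose a ha had using htm
  refine ⟨Struct.homMk (X := α.shape) (Y := X) (fun j x => A j x.down.down)
    (fun j x => a j x.down.down) (fun j x => h.bd j x.down.down) (fun j x => ha j x.down.down),
    -- `Compat` also counts `α.last` as kept, being a value of `α`, while `P` is unconstrained
    -- there; the correction does not affect positions below `α.last`.
    fun j => P j || j == α.last, ⟨fun j hj => ?_, h.ty, fun j hj hα' => had j ⟨hj, hα'⟩⟩,
    fun j hj => by simp [hj.ne], rfl⟩
  rcases eq_or_lt_of_le hj with rfl | hj'
  · simpa using ⟨Fin.last n, rfl⟩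
  · simp [hα j hj', hj'.ne]

/-- The context length counts the kept positions of the chain, so the resulting inc-list has the
length dictated by the degree. -/
theorem exists_eq_typeExpr {Γ : List (Expr (Alphabet X))} {T} {n : ℕ}
    (hd : Derives (freeBasic X) ⟨Γ, .type T⟩) (hn : Γ.length = n) :
    ∃ (α : Inc n) (g : α.shape ⟶ X), Γ = ctxOf α g ∧ T = typeExpr α g := by
  obtain ⟨c, d, P, N, A, h, hΓ, hT⟩ := isChain_of_derives hd (.inl rfl)
  dsimp only at hΓ hT
  obtain ⟨α, rfl, hα⟩ := exists_inc P N (n := n) (by rw [← hn, hΓ, length_chainCtx])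
  obtain ⟨g, Q, hc, hQ, -⟩ := h.exists_compat hα
  exact ⟨α, g, by rw [hΓ, hc.ctxOf_eq, chainCtx_congr c d hQ],
    by rw [hT, hc.typeExpr_eq, chainTy_congr c d hQ]⟩

theorem exists_eq_termExpr {Γ : List (Expr (Alphabet X))} {t T} {n : ℕ}
    (hd : Derives (freeBasic X) ⟨Γ, .term t T⟩) (hn : Γ.length = n) :
    ∃ (α : Inc n) (g : α.shape ⟶ X) (a : X.TmOver (lblTy g α.last le_rfl)),
      Γ = ctxOf α g ∧ T = typeExpr α g ∧ t = termExpr α g a := by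
  obtain ⟨c, d, P, N, A, h, hΓ, hT, a, ha, ht⟩ := isChain_of_derives hd (.inr rfl)
  dsimp only at hΓ hT
  obtain ⟨α, rfl, hα⟩ := exists_inc P N (n := n) (by rw [← hn, hΓ, length_chainCtx])
  obtain ⟨g, Q, hc, hQ, hg⟩ := h.exists_compat hα
  let a' : X.TmOver (lblTy g α.last le_rfl) := ⟨a, ha.trans hg.symm⟩
  refine ⟨α, g, a', by rw [hΓ, hc.ctxOf_eq, chainCtx_congr c d hQ],
    by rw [hT, hc.typeExpr_eq, chainTy_congr c d hQ], ?_⟩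
  rw [ht, hc.termExpr_eq a']
  congr 1
  funext i
  exact chainArg_congr d hQ i.1 i.2

/-- All type labels are iterated boundaries of the top one; hence a descending induction. -/
theorem lblTy_congr {n : ℕ} {α : Inc n} {g g' : α.shape ⟶ X}
    (h : lblTy g α.last le_rfl = lblTy g' α.last le_rfl) (j : ℕ) (hj : j ≤ α.last) :
    lblTy g j hj = lblTy g' j hj := by
  induction hj using Nat.decreasingInduction with
  | self => exact h
  | of_succ k hk ih => rw [← bdTy_lblTy g k hk, ih, bdTy_lblTy]

theorem argExpr_of_notMem {n : ℕ} {α : Inc n} (g : α.shape ⟶ X) {j : ℕ} (hj : j ≤ α.last)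
    (hα : j ∉ Set.range α) : argExpr α g j hj =
      .app (.inr ⟨j, lblTm g j hj hα⟩) j fun i => argExpr α g i.1 (i.2.le.trans hj) := by
  rw [argExpr, dif_neg hα]

theorem argExpr_val {n : ℕ} (α : Inc n) (g : α.shape ⟶ X) (p : Fin (n + 1)) (hp : α p ≤ α.last) :
    argExpr α g (α p) hp = .var p.1 := by
  have hα : α p ∈ Set.range α := ⟨p, rfl⟩
  rw [argExpr, dif_pos hα, α.injective (Classical.choose_spec hα)]

/-- Values of an inc-list are recognisable from the syntax: they are the positions filled by a
variable rather than by an application. -/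
theorem mem_range_of_argExpr_eq {n n' : ℕ} {α : Inc n} {α' : Inc n'} {g : α.shape ⟶ X}
    {g' : α'.shape ⟶ X} {j : ℕ} {hj : j ≤ α.last} {hj' : j ≤ α'.last}
    (h : argExpr α g j hj = argExpr α' g' j hj') (hα : j ∈ Set.range α) : j ∈ Set.range α' := by
  by_contra hα'
  obtain ⟨p, rfl⟩ := hα
  rw [argExpr_val, argExpr_of_notMem g' hj' hα'] at h
  cases h

/-- A labelled inc-list is determined by its last type. -/
theorem typeExpr_injective {n : ℕ} {α α' : Inc n} {g : α.shape ⟶ X} {g' : α'.shape ⟶ X}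
    (h : typeExpr α g = typeExpr α' g') :
    (⟨α, g⟩ : Σ α : Inc n, α.shape ⟶ X) = ⟨α', g'⟩ := by
  obtain ⟨hw, hl, harg⟩ := Expr.app_inj h
  dsimp only at harg
  -- Below the last value the arguments tell which positions are values, and the last value is read
  -- off from the arity of the head. A strictly increasing function is then recovered from its
  -- range.
  have hr : Set.range α = Set.range α' := by
    have hle : ∀ {α α' : Inc n}, α.last = α'.last →
        (∀ j < α.last, j ∈ Set.range α → j ∈ Set.range α') → Set.range α ⊆ Set.range α' := by
      rintro α α' hl h _ ⟨p, rfl⟩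
      rcases eq_or_lt_of_le (α.le_last p) with e | hlt
      · exact ⟨Fin.last n, hl.symm.trans e.symm⟩
      · exact h _ hlt ⟨p, rfl⟩
    exact (hle hl fun j hj => mem_range_of_argExpr_eq (harg j hj (hl ▸ hj))).antisymm
      (hle hl.symm fun j hj => mem_range_of_argExpr_eq (harg j (hl ▸ hj) hj).symm)
  obtain rfl : α = α' := DFunLike.coe_injective ((α.strictMono.range_inj α'.strictMono).1 hr)
  have hlast : lblTy g α.last le_rfl = lblTy g' α.last le_rfl := by simpa using hw
  congr 1
  refine Struct.hom_ext (X := α.shape) (Y := X) (fun j x => lblTy_congr hlast j x.down.down)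
    fun j x => ?_
  obtain ⟨hj, hα⟩ := x.down.down
  have hlt : j < α.last := lt_of_le_of_ne hj fun e => hα ⟨Fin.last n, e.symm⟩
  -- At a position that is not a value of `α`, the argument has the term label as its head constant.
  have := harg j hlt hlt
  rw [argExpr_of_notMem g hj hα, argExpr_of_notMem g' hj hα] at this
  exact eq_of_heq (Sigma.mk.inj (Sum.inr.inj (Expr.app_inj this).1)).2

theorem termExpr_injective {n : ℕ} {α : Inc n} {g : α.shape ⟶ X} {a a'}
    (h : termExpr α g a = termExpr α g a') : a = a' :=
  Subtype.ext (by simpa using (Expr.app_inj h).1)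

/-- Classes in the free theory are singletons, so expressions can be read off from elements of `SX`.
-/
theorem eq_of_tyMk_eq {n : ℕ} {J K : (freeGAT X).Judg .type n}
    (h : (freeGAT X).tyMk J = (freeGAT X).tyMk K) : J = K :=
  Subtype.ext (Subtype.ext (eq_of_congr_free (GAT.tyMk_eq.1 h)))

theorem eq_of_tmMk_eq {n : ℕ} {J K : (freeGAT X).Judg .term n}
    (h : (freeGAT X).tmMk J = (freeGAT X).tmMk K) : J = K :=
  Subtype.ext (Subtype.ext (eq_of_congr_free (GAT.tmMk_eq.1 h)))

theorem exists_tyMk_free {n : ℕ} (B : (substMonad.obj X).Ty n) : ∃ (α : Inc n) (g : α.shape ⟶ X),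
    B = tyElem α g := by
  obtain ⟨Γ, D, hd, hl, rfl⟩ := exists_tyMk (T := freeGAT X) B
  obtain ⟨α, g, rfl, rfl⟩ := exists_eq_typeExpr hd (Nat.succ_injective hl)
  exact ⟨α, g, rfl⟩

/-- Surjectivity is the existence of normal forms. For injectivity the last types suffice; the
contexts need not be compared. -/
theorem tyElem_bijective (n : ℕ) :
    Function.Bijective fun p : (Σ α : Inc n, α.shape ⟶ X) => tyElem p.1 p.2 := by
  constructor
  · rintro ⟨α, g⟩ ⟨α', g'⟩ h
    have := congrArg (fun J => J.1.1.body) (eq_of_tyMk_eq h)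
    exact typeExpr_injective (Body.type.inj this)
  · intro B
    obtain ⟨α, g, rfl⟩ := exists_tyMk_free B
    exact ⟨⟨α, g⟩, rfl⟩

theorem tmElem_bijective {n : ℕ} (α : Inc n) (g : α.shape ⟶ X) :
    Function.Bijective (tmElem α g) := by
  constructor
  · intro a a' h
    have := congrArg (fun J => J.1.1.body) (eq_of_tmMk_eq (congrArg Subtype.val h))
    exact termExpr_injective (Body.term.inj this).1
  · rintro ⟨b, hb⟩
    obtain ⟨Γ, t, D, hd, hl, rfl⟩ := exists_tmMk (T := freeGAT X) b
    obtain ⟨α', g', a, rfl, rfl, rfl⟩ := exists_eq_termExpr hd (Nat.succ_injective hl)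
    -- The boundary of the normal form found for `b` is by definition the element of `(α', g')`, and
    -- `hb` says that it is also that of `(α, g)`.
    have e : (⟨α', g'⟩ : Σ α : Inc n, α.shape ⟶ X) = ⟨α, g⟩ := (tyElem_bijective n).1 hb
    cases e
    exact ⟨a, rfl⟩

end
-- Classification of the elements of `S²X`
namespace SqCode
variable {X : Struct.{u}} {n : ℕ}

/-- Uniqueness of normal forms over `SX` recovers `α` and the labelling. Uniqueness over `X`,
applied to the top type label, recovers `β` and `h`; applied to the term labels, it recovers `k`. -/
theorem ty_injective : Function.Injective fun s : SqCode X n => s.ty := by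
  intro s s' h
  have e : (⟨s.α, s.label⟩ : Σ α : Inc n, α.shape ⟶ substMonad.obj X) = ⟨s'.α, s'.label⟩ :=
    (tyElem_bijective n).1 h
  rcases s with ⟨α, β, g, k⟩
  rcases s' with ⟨α', β', g', k'⟩
  obtain ⟨e₁, e₂⟩ := Sigma.mk.inj e
  dsimp only at e₁
  subst e₁
  have e₂ := eq_of_heq e₂
  -- The label at the last value of `α` is the unrestricted element `(β, h)`.
  have e₃ := (lblTy_label_last ⟨α, β, g, k⟩).symm.trans
    ((congrArg (fun l => lblTy l α.last le_rfl) e₂).trans (lblTy_label_last ⟨α, β', g', k'⟩))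
  obtain ⟨e₄, e₅⟩ := Sigma.mk.inj ((tyElem_bijective α.last).1 (a₁ := ⟨β, g⟩) (a₂ := ⟨β', g'⟩) e₃)
  subst e₄
  obtain rfl := eq_of_heq e₅
  congr 1
  funext j hj hα
  exact (tmElem_bijective (β.res j hj) (lblRes g j hj)).1
    (Subtype.ext (congrArg (fun l => lblTm l j hj hα) e₂))

theorem ty_surjective : Function.Surjective fun s : SqCode X n => s.ty := by
  intro B
  obtain ⟨⟨α, l⟩, rfl⟩ := (tyElem_bijective n).2 B
  obtain ⟨⟨β, g⟩, hg⟩ := (tyElem_bijective α.last).2 (lblTy l α.last le_rfl)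
  dsimp only at hg
  -- The top label is some `(β, g)`, and taking boundaries restricts it. So every type label is the
  -- corresponding restriction, and the term labels lie over these restrictions.
  have hl : ∀ j (hj : j ≤ α.last), lblTy l j hj = tyElem (β.res j hj) (lblRes g j hj) := by
    intro j hj
    induction hj using Nat.decreasingInduction with
    | self => exact hg.symm.trans (congrArg (tyElem β) (lblRes_self g).symm)
    | of_succ j hj ih =>
      rw [← bdTy_lblTy l j hj, ih, bdTy_tyElem]
      exact congrArg (tyElem (β.res j (j.le_succ.trans hj))) (lblRes_lblRes g (j + 1) hj j j.le_succ)
  have hk : ∀ j (hj : j ≤ α.last) (hα : j ∉ Set.range α),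
      ∃ a, (tmElem (β.res j hj) (lblRes g j hj) a).1 = lblTm l j hj hα := by
    intro j hj hα
    obtain ⟨a, ha⟩ := (tmElem_bijective (β.res j hj) (lblRes g j hj)).2
      ⟨lblTm l j hj hα, (bdTm_lblTm l j hj hα).trans (hl j hj)⟩
    exact ⟨a, congrArg Subtype.val ha⟩
  choose k hk using hk
  refine ⟨⟨α, β, g, k⟩, congrArg (tyElem α) ?_⟩
  exact Struct.hom_ext (X := α.shape) (Y := substMonad.obj X) (fun j x => (hl j x.down.down).symm)
    fun j x => hk j x.down.down.1 x.down.down.2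

/-- Composite of two instances of `tmElem_bijective`, one over `X` and one over `SX`. -/
theorem tm_bijective (s : SqCode X n) : Function.Bijective s.tm := by
  constructor
  · intro a a' h
    have h' := (tmElem_bijective s.α s.label).1 h
    exact (tmElem_bijective s.β s.h).1 (Subtype.ext (Subtype.mk.inj h'))
  · intro b
    obtain ⟨b, rfl⟩ := (tmElem_bijective s.α s.label).2 b
    obtain ⟨a, ha⟩ := (tmElem_bijective s.β s.h).2 ⟨b.1, b.2.trans s.lblTy_label_last⟩
    exact ⟨a, congrArg (tmElem s.α s.label) (Subtype.ext (congrArg (fun x => x.1) ha))⟩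

end SqCode

/-! ## The multiplication -/

section
variable {X : Struct.{u}}

/-- The multiplication is induced by the translation of expressions that replaces each constant
by a representative. -/
theorem substMonad_μ_app (c : Alphabet X) : substMonad.μ.app X =
    (transInterp (X := substMonad.obj X) (T := freeGAT X) (𝟙 _) c).toStructHom := by
  have h : freeForgetful.counit.app (freeGAT X) =
      (Quotient.mk _ (transInterp (X := substMonad.obj X) (T := freeGAT X) (𝟙 _) c) :
        freeGAT (substMonad.obj X) ⟶ freeGAT X) := by
    -- The counit is the transpose of the identity, and the translation along the identity restricts
    -- to the identity on generators. The filler `c` plays no role in this.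
    apply (freeHomEquiv (substMonad.obj X) (freeGAT X)).injective
    refine Eq.trans ?_ (freeUnit_transInterp (X := substMonad.obj X) (T := freeGAT X) (𝟙 _) c).symm
    exact (freeHomEquiv (substMonad.obj X) (freeGAT X)).apply_symm_apply (𝟙 _)
  exact congrArg GAT.forgetful.map h

end

/-! ### Flattening expressions over `SX` -/

section
variable {X : Struct.{u}}

/-- Although `tyRep` is obtained by choice, a class with a single member leaves no choice. -/
theorem tyRep_tyElem {n : ℕ} (β : Inc n) (g : β.shape ⟶ X) :
    (tyRep (X := substMonad.obj X) (T := freeGAT X) (𝟙 _) n (tyElem β g)).1.2 = typeExpr β g := by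
  obtain ⟨h, hl, e⟩ := (tyRep (X := substMonad.obj X) (T := freeGAT X) (𝟙 _) n (tyElem β g)).2
  exact (Body.type.inj (congrArg (fun J => J.1.1.body) (eq_of_tyMk_eq e))).symm

theorem tmRep_tmElem {n : ℕ} (β : Inc n) (g : β.shape ⟶ X) (a) :
    tmRep (X := substMonad.obj X) (T := freeGAT X) (𝟙 _) (tmElem β g a).1 = termExpr β g a := by
  obtain ⟨h, hl, e⟩ := Classical.choose_spec
    (tmRep_exists (X := substMonad.obj X) (T := freeGAT X) (𝟙 _) (tmElem β g a).1)
  exact (Body.term.inj (congrArg (fun J => J.1.1.body) (eq_of_tmMk_eq e))).1.symm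

/-- A chain compatible with a labelled inc-list is compatible with its restrictions, so both sides
are the same chain expression. -/
theorem argExpr_res {n : ℕ} (β : Inc n) (g : β.shape ⟶ X) (m : ℕ) (hm : m ≤ n) (j : ℕ)
    (hj : j ≤ (β.res m hm).last) : argExpr (β.res m hm) (lblRes g m hm) j hj =
      argExpr β g j (hj.trans (β.last_res_le m hm)) := by
  obtain ⟨c, d, P, hc⟩ := exists_compat β g
  rw [(hc.res m hm).argExpr_eq, hc.argExpr_eq]

theorem bind_typeExpr {n : ℕ} (β : Inc n) (g : β.shape ⟶ X) (σ) : (typeExpr β g).bind σ =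
    .app (.inl ⟨β.last, lblTy g β.last le_rfl⟩) β.last
      fun i => (argExpr β g i.1 i.2.le).bind σ := rfl

theorem bind_termExpr {n : ℕ} (β : Inc n) (g : β.shape ⟶ X) (a) (σ) : (termExpr β g a).bind σ =
    .app (.inr ⟨β.last, a.1⟩) β.last fun i => (argExpr β g i.1 i.2.le).bind σ := rfl

namespace SqCode
variable {n : ℕ} (s : SqCode X n) (c : Alphabet X)

/-- Translation of expressions over the elements of `SX`. -/
noncomputable abbrev flatten : Expr (Alphabet (substMonad.obj X)) → Expr (Alphabet X) :=
  Expr.trans (X := substMonad.obj X) (T := freeGAT X) (𝟙 _) c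

/-- The simultaneous substitution that replaces each variable of `(β, h)` by the translation of the
expression that `(α, (β, h, k))` puts in its place. -/
noncomputable def flattenArg (N i : ℕ) : Expr (Alphabet X) :=
  -- `N` is the arity of the application being translated: `Expr.trans` puts the closed filler `c`
  -- for variables from `N` on. The second condition only makes the argument expression meaningful.
  if h : i < N ∧ i ≤ s.α.last then flatten c (argExpr s.α s.label i h.2) else .app c 0 Fin.elim0

theorem flattenArg_of_lt {N i : ℕ} (h : i < N) (h' : i ≤ s.α.last) :
    s.flattenArg c N i = flatten c (argExpr s.α s.label i h') := dif_pos ⟨h, h'⟩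

theorem flatten_app (w) (N : ℕ) (hN : N ≤ s.α.last) :
    flatten c (.app w N fun i => argExpr s.α s.label i.1 (i.2.le.trans hN)) =
      (conRep (X := substMonad.obj X) (T := freeGAT X) (𝟙 _) w).bind (s.flattenArg c N) := by
  refine congrArg (Expr.bind _) (funext fun i => ?_)
  by_cases h : i < N
  · rw [dif_pos h, s.flattenArg_of_lt c h (h.le.trans hN)]
  · rw [dif_neg h, flattenArg, dif_neg fun h' => h h'.1]
    rfl

/-- Flattening the expressions of `(β, h)` along those of `(α, (β, h, k))` gives those of
`(βα, h ∪ k)`. -/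
theorem argExpr_bind (i : ℕ) (hi : i ≤ s.β.last) (N : ℕ)
    (hiN : ∀ q : Fin (s.α.last + 1), s.β q ≤ i → q.1 < N) :
    (argExpr s.β s.h i hi).bind (s.flattenArg c N) = argExpr s.comp s.union i hi := by
  -- The cut-off `N` varies because passing into the representative of some `k(j)` lowers it to `j`.
  -- The hypothesis `hiN` keeps the filler out: the variables that can occur at position `i` are the
  -- `q` with `β q ≤ i`.
  induction i using Nat.strong_induction_on generalizing N with
  | _ i ih =>
  by_cases hβ : i ∈ Set.range s.β
  · obtain ⟨⟨j, hj⟩, rfl⟩ := hβ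
    have hj' : j ≤ s.α.last := Nat.le_of_lt_succ hj
    rw [argExpr_val, Expr.bind, s.flattenArg_of_lt c (hiN _ le_rfl) hj']
    by_cases hα : j ∈ Set.range s.α
    · obtain ⟨p, rfl⟩ := hα
      rw [argExpr_val]
      exact (argExpr_val s.comp s.union p hi).symm
    · have hcomp : s.β ⟨j, hj⟩ ∉ Set.range s.comp := by
        rintro ⟨p, hp⟩
        exact hα ⟨p, congrArg Fin.val (s.β.injective hp)⟩
      rw [argExpr_of_notMem s.label hj' hα, s.flatten_app c _ j hj',
        argExpr_of_notMem s.union hi hcomp]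
      have hl : lblTm s.union (s.β ⟨j, hj⟩) hi hcomp = (s.k j hj' hα).1 :=
        congrArg (fun a => a.1) (s.unionTm_val j hj' hα hi hcomp)
      rw [hl]
      -- The label at `j` is the class of `k(j)` over the restriction of `(β, h)` to `j`, so its
      -- representative has head `k(j)` and as arguments the expressions of `(β, h)` at positions
      -- below `β(j)`.
      have hr : conRep (X := substMonad.obj X) (T := freeGAT X) (𝟙 _)
          (.inr ⟨j, lblTm s.label j hj' hα⟩) =
          termExpr (s.β.res j hj') (lblRes s.h j hj') (s.k j hj' hα) :=
        tmRep_tmElem (s.β.res j hj') (lblRes s.h j hj') (s.k j hj' hα)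
      rw [hr]
      refine (bind_termExpr _ _ _ _).trans (congrArg (Expr.app _ _) (funext fun i => ?_))
      rw [argExpr_res]
      -- From `β q ≤ i < β j` follows `q < j`, so the cut-off `j` is large enough.
      exact ih i.1 i.2 _ j fun q hq =>
        Fin.lt_def.1 (s.β.lt_iff_lt.1 (hq.trans_lt i.2))
  · have hcomp : i ∉ Set.range s.comp := by
      rintro ⟨p, hp⟩
      exact hβ ⟨_, hp⟩
    rw [argExpr_of_notMem s.h hi hβ, argExpr_of_notMem s.union hi hcomp]
    have hl : lblTm s.union i hi hcomp = lblTm s.h i hi hβ := s.unionTm_of_notMem i hi hcomp hβ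
    rw [hl]
    refine congrArg (Expr.app _ i) (funext fun l => ?_)
    exact ih l.1 l.2 _ N fun q hq => hiN q (hq.trans l.2.le)

theorem argExpr_bind_lt (i : Fin s.β.last) :
    (argExpr s.β s.h i.1 i.2.le).bind (s.flattenArg c s.α.last) =
      argExpr s.comp s.union i.1 i.2.le :=
  s.argExpr_bind c i.1 i.2.le _ fun _ hq =>
    Fin.lt_def.1 (s.β.lt_iff_lt.1 (hq.trans_lt i.2))

/-- The head `(β, h)` is represented by its own last type, whose head and arity survive; the
arguments are handled by `argExpr_bind`. -/
theorem flatten_typeExpr : flatten c (typeExpr s.α s.label) = typeExpr s.comp s.union := by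
  rw [typeExpr, s.flatten_app c _ _ le_rfl]
  have hr : conRep (X := substMonad.obj X) (T := freeGAT X) (𝟙 _)
      (.inl ⟨s.α.last, lblTy s.label s.α.last le_rfl⟩) = typeExpr s.β s.h := by
    rw [lblTy_label_last]
    exact tyRep_tyElem s.β s.h
  rw [hr]
  exact (bind_typeExpr _ _ _).trans
    (congrArg (Expr.app _ s.β.last) (funext (s.argExpr_bind_lt c)))

theorem flatten_termExpr (a : X.TmOver (lblTy s.h s.β.last le_rfl)) :
    flatten c (termExpr s.α s.label
      ⟨(tmElem s.β s.h a).1, (tmElem s.β s.h a).2.trans s.lblTy_label_last.symm⟩) =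
    termExpr s.comp s.union a := by
  refine (s.flatten_app c _ _ le_rfl).trans ?_
  have hr : conRep (X := substMonad.obj X) (T := freeGAT X) (𝟙 _)
      (.inr ⟨s.α.last, (tmElem s.β s.h a).1⟩) = termExpr s.β s.h a := tmRep_tmElem s.β s.h a
  refine (congrArg (fun e => Expr.bind e _) hr).trans ?_
  exact (bind_termExpr _ _ _ _).trans
    (congrArg (Expr.app _ s.β.last) (funext (s.argExpr_bind_lt c)))

theorem mapTy_μ : Struct.mapTy (substMonad.μ.app X) s.ty = tyElem s.comp s.union := by
  -- Any constant can serve as filler; the top label of `h` shows that one exists.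
  let c : Alphabet X := .inl ⟨_, lblTy s.h s.β.last le_rfl⟩
  -- With the image put in normal form first, only its last type has to be computed; the translated
  -- context need not be examined.
  obtain ⟨α, g, e⟩ := exists_tyMk_free (Struct.mapTy (substMonad.μ.app X) s.ty)
  rw [e]
  rw [substMonad_μ_app c] at e
  have := Body.type.inj (congrArg (fun J => J.1.1.body) (eq_of_tyMk_eq (n := n) e))
  have he := typeExpr_injective (this.symm.trans (s.flatten_typeExpr c))
  exact congrArg (fun p : (Σ α : Inc n, α.shape ⟶ X) => tyElem p.1 p.2) he

theorem mapTm_μ (a : X.TmOver (lblTy s.h s.β.last le_rfl)) :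
    Struct.mapTm (substMonad.μ.app X) (s.tm a).1 = (tmElem s.comp s.union a).1 := by
  let c : Alphabet X := .inl ⟨_, lblTy s.h s.β.last le_rfl⟩
  -- By `mapTy_μ` the image lies over `(βα, h ∪ k)`, so it comes from some `a'`; the flattened term
  -- then forces `a' = a`.
  obtain ⟨a', e⟩ := (tmElem_bijective s.comp s.union).2
    ⟨Struct.mapTm (substMonad.μ.app X) (s.tm a).1, (Struct.bdTm_mapTm _ _).trans
      ((congrArg (Struct.mapTy (substMonad.μ.app X)) (s.tm a).2).trans s.mapTy_μ)⟩
  have e : (tmElem s.comp s.union a').1 = Struct.mapTm (substMonad.μ.app X) (s.tm a).1 :=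
    congrArg (fun b => b.1) e
  rw [← e]
  rw [substMonad_μ_app c] at e
  have := (Body.term.inj (congrArg (fun J => J.1.1.body) (eq_of_tmMk_eq (n := n) e))).1
  rw [termExpr_injective (this.trans (s.flatten_termExpr c a))]

end SqCode
end
end SubstMonad

theorem mainTheorem10 (X : Struct.{u}) (n : ℕ) :
    -- type-elements of `SX` are the pairs `(α, h)`, and term-elements over them those of `X`
    (Function.Bijective
      fun p : (Σ α : Inc n, α.shape ⟶ X) => tyElem p.1 p.2) ∧
    (∀ (α : Inc n) (h : α.shape ⟶ X), Function.Bijective (tmElem α h)) ∧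
    -- type-elements of `S²X` are the data `(α, (β, h, k))`, and term-elements over them those of `X`
    (Function.Bijective fun s : SqCode X n => s.ty) ∧
    (∀ s : SqCode X n, Function.Bijective s.tm) ∧
    -- the multiplication
    (∀ s : SqCode X n, Struct.mapTy (substMonad.μ.app X) s.ty = tyElem s.comp s.union) ∧
    (∀ (s : SqCode X n) (a : X.TmOver (lblTy s.h s.β.last le_rfl)),
      Struct.mapTm (substMonad.μ.app X) (s.tm a).1 = (tmElem s.comp s.union a).1) := by
  exact ⟨tyElem_bijective n, tmElem_bijective, ⟨SqCode.ty_injective, SqCode.ty_surjective⟩,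
    SqCode.tm_bijective, SqCode.mapTy_μ, SqCode.mapTm_μ⟩
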